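/- **Setting.** A (finite) recursive Markov decision process (RMDP) $M$ consists of finitely many components $M_1,\dots,M_k$. Component $M_i$ has a finite non-empty set $A_i$ of actions, a finite set $N_i$ of nodes with disjoint ordered subsets of entry nodes $\mathrm{En}_i$ and exit nodes $\mathrm{Ex}_i$, and a finite set $B_i$ of boxes, each box $b$ calling a component $Y(b)$. A box $b$ has call ports $(b,en)$, $en\in \mathrm{En}_{Y(b)}$, and return ports $(b,ex)$, $ex\in\mathrm{Ex}_{Y(b)}$. Nodes and ports are the vertices. For every source $q$ of $M_i$ (a non-exit node or a return port) and $a\in A_i$, there are a probability distribution $\delta(q,a)$ on the targets of $M_i$ (non-entry nodes and call ports) and a reward $r(q,a)\in\mathbb R$. A state is a pair $(\kappa,q)$ of a well-formed stack $\kappa$ of pending boxes and a vertex $q$. At a call port $(b,en)$ the box $b$ is pushed and the process moves to $en$; at an exit $ex$ the top box $b$ is popped and the process moves to $(b,ex)$, or, if the stack is empty, terminates; these steps have reward $0$. At any other vertex the strategy's action $a$ yields reward $r(q,a)$, and the next vertex is drawn from $\delta(q,a)$. Strategies are history-dependent and may randomize. The stack height is $|\kappa|+1$, and $0$ after termination.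 $\mathrm{ETotal}^M_\sigma(s)$ is the limit as $N\to\infty$ of the expected reward in the first $N$ steps from $s$ under $\sigma$, and $\mathrm{ETotal}^M(s)=\sup_\sigma \mathrm{ETotal}^M_\sigma(s)$. An RMDP $M'$ is $\varepsilon$-close to $M$ if it differs from $M$ only in its transition function, $\sum_{q,a,v}|\delta_M(q,a)(v)-\delta_{M'}(q,a)(v)|\le\varepsilon$, and $\operatorname{supp}\delta_{M'}(q,a)\subseteq\operatorname{supp}\delta_M(q,a)$ for all $q,a$. For $\varepsilon>0$, $M$ is $\varepsilon$-proper if for every strategy $\sigma$ and state $s$ the expected number of steps to termination is bounded uniformly over all $M'$ that are $\varepsilon$-close to $M$. We say that an $\varepsilon$-proper $M$ has parameters $c_o\ge1$, $\mu\in(0,1]$ and $b$ if, for all $M'$ $\varepsilon$-close to $M$, all strategies $\sigma$, all vertices $q$ and all $k\ge0$, started from $q$ with the empty stack, the expected stack height after $k$ steps is at most $c_o-\mu\sum_{i=1}^k p^{M'_\sigma}_{\mathrm{run}}(i)$, where $p^{M'_\sigma}_{\mathrm{run}}(i)$ is the probability of still running after $i$ steps, and $|\mathrm{ETotal}^{M'}_\sigma((\langle\emptyset\rangle,q))|\le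 b$. **Theorem.** For $\varepsilon$-proper RMDPs with parameters $c_o,\mu,b$ the optimal expected total reward is PAC-learnable. That is, there is one algorithm (given by total computable functions) with the following property. It receives natural-number upper bounds for $c_o$, $1/\mu$, $b$, $1/\alpha$ and $1/\beta$ (where $\alpha,\beta>0$), the finite structure of the RMDP (components, nodes, boxes and actions, but neither $\delta$ nor $r$), and a state $s$. From these data it computes a number $N$ and a precision $\eta=1/(n+1)$; then every pair $(q,a)$ of a source and an available action is sampled $N$ times, all samples being independent, each sample consisting of $q$, $a$, a fixed integer multiple of $\eta$ that differs from $r(q,a)$ by at most $\eta$, and a successor drawn from $\delta(q,a)$; from the samples it computes a rational number $v$. For all real $\varepsilon>0$, $c_o\ge1$, $\mu\in(0,1]$, $b$, all real $\alpha,\beta>0$, every $\varepsilon$-proper RMDP $M$ with parameters $c_o,\mu,b$, and every state $s$ of $M$, whenever the bounds given are correct, $$\Pr\bigl(|v-\mathrm{ETotal}^M(s)|\le\alpha\bigr)\ \ge\ 1-\beta .$$ -/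

import Mathlib

/-! # Recursive Markov decision processes and PAC learning of the optimal total reward -/

noncomputable section

namespace RecMDP

/-! ## Syntax -/

/-- The vertices of an RMDP. The first index is the number of the component the vertex lies in.
`call i b j` is the call port of the `b`-th box of component `i` for the `j`-th entry of the
component called by this box; `ret i b j` is its return port for the `j`-th exit. -/
inductive Vertex where
  | entry (i j : ℕ)
  | inner (i j : ℕ)
  | exit (i j : ℕ)
  | call (i b j : ℕ)
  | ret (i b j : ℕ)
  deriving DecidableEq

/-- The index of the component in which a vertex lies. -/
def Vertex.comp : Vertex → ℕ
  | .entry i _ => i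
  | .inner i _ => i
  | .exit i _ => i
  | .call i _ _ => i
  | .ret i _ _ => i

def vertexEquiv : Vertex ≃ (ℕ × ℕ) ⊕ (ℕ × ℕ) ⊕ (ℕ × ℕ) ⊕ (ℕ × ℕ × ℕ) ⊕ (ℕ × ℕ × ℕ) where
  toFun
    | .entry i j => .inl (i, j)
    | .inner i j => .inr (.inl (i, j))
    | .exit i j => .inr (.inr (.inl (i, j)))
    | .call i b j => .inr (.inr (.inr (.inl (i, b, j))))
    | .ret i b j => .inr (.inr (.inr (.inr (i, b, j))))
  invFun
    | .inl (i, j) => .entry i j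
    | .inr (.inl (i, j)) => .inner i j
    | .inr (.inr (.inl (i, j))) => .exit i j
    | .inr (.inr (.inr (.inl (i, b, j)))) => .call i b j
    | .inr (.inr (.inr (.inr (i, b, j)))) => .ret i b j
  left_inv := by rintro (_ | _ | _ | _ | _) <;> rfl
  right_inv := by rintro (_ | _ | _ | _ | _) <;> rfl

instance : Primcodable Vertex := Primcodable.ofEquiv _ vertexEquiv

/-- The finite data of a component, without transition probabilities and rewards: the numbers of
actions, of entry nodes, of exit nodes, of the remaining nodes, and, for every box of the component,
the index of the component that the box calls. The actions of the component are the numbers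
`0, …, actions - 1`, and likewise for nodes and boxes. -/
structure Component where
  actions : ℕ
  entries : ℕ
  exits : ℕ
  inners : ℕ
  boxes : List ℕ

instance : Inhabited Component := ⟨⟨0, 0, 0, 0, []⟩⟩

def componentEquiv : Component ≃ ℕ × ℕ × ℕ × ℕ × List ℕ where
  toFun C := (C.actions, C.entries, C.exits, C.inners, C.boxes)
  invFun x := ⟨x.1, x.2.1, x.2.2.1, x.2.2.2.1, x.2.2.2.2⟩
  left_inv _ := rfl
  right_inv _ := rfl

instance : Primcodable Component := Primcodable.ofEquiv _ componentEquiv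

/-- The underlying finite structure of an RMDP: its list of components. -/
abbrev Frame := List Component

namespace Frame

/-- The `i`-th component (a component without any vertex if `i` is out of range). -/
def comp (F : Frame) (i : ℕ) : Component := F.getD i default

/-- The component called by the `b`-th box of component `i`. -/
def callee (F : Frame) (i b : ℕ) : ℕ := (F.comp i).boxes.getD b 0

/-- Every component has an action, and every box calls an existing component. -/
def WF (F : Frame) : Prop :=
  ∀ C ∈ F, 1 ≤ C.actions ∧ ∀ y ∈ C.boxes, y < F.length

def IsVertex (F : Frame) : Vertex → Prop
  | .entry i j => j < (F.comp i).entries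
  | .inner i j => j < (F.comp i).inners
  | .exit i j => j < (F.comp i).exits
  | .call i b j => b < (F.comp i).boxes.length ∧ j < (F.comp (F.callee i b)).entries
  | .ret i b j => b < (F.comp i).boxes.length ∧ j < (F.comp (F.callee i b)).exits

/-- The number of actions available at a vertex. -/
def numActions (F : Frame) (v : Vertex) : ℕ := (F.comp v.comp).actions

/-- All sources of probabilistic transitions (entry nodes, inner nodes and return ports) of the
`i`-th component. -/
def sources (F : Frame) (i : ℕ) : List Vertex :=
  (List.range (F.comp i).entries).map (.entry i) ++
  (List.range (F.comp i).inners).map (.inner i) ++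
  (List.range (F.comp i).boxes.length).flatMap fun b =>
    (List.range (F.comp (F.callee i b)).exits).map (.ret i b)

/-- All pairs of a source of probabilistic transitions and an action available there. -/
def queries (F : Frame) : List (Vertex × ℕ) :=
  (List.range F.length).flatMap fun i =>
    (F.sources i).flatMap fun v => (List.range (F.comp i).actions).map fun a => (v, a)

end Frame

/-- Entry nodes, inner nodes and return ports; transitions from these are probabilistic. -/
def Vertex.IsSource : Vertex → Prop
  | .entry _ _ => True
  | .inner _ _ => True
  | .exit _ _ => False
  | .call _ _ _ => False
  | .ret _ _ _ => True

instance : DecidablePred Vertex.IsSource := fun v => by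
  cases v <;> unfold Vertex.IsSource <;> infer_instance

/-- Inner nodes, exit nodes and call ports; probabilistic transitions lead to these. -/
def Vertex.IsTarget : Vertex → Prop
  | .entry _ _ => False
  | .inner _ _ => True
  | .exit _ _ => True
  | .call _ _ _ => True
  | .ret _ _ _ => False

theorem Frame.comp_of_le (F : Frame) {i : ℕ} (h : F.length ≤ i) : F.comp i = default := by
  unfold Frame.comp
  exact List.getD_eq_default _ _ h

/-- The list `queries` contains exactly the intended pairs. -/
theorem Frame.mem_queries (F : Frame) (v : Vertex) (a : ℕ) :
    (v, a) ∈ F.queries ↔ F.IsVertex v ∧ v.IsSource ∧ a < F.numActions v := by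
  have key : ∀ i, a < (F.comp i).actions → i < F.length := by
    intro i h
    by_contra hi
    rw [F.comp_of_le (not_lt.mp hi)] at h
    exact absurd h (Nat.not_lt_zero a)
  constructor
  · intro h
    simp only [queries, sources, List.mem_flatMap, List.mem_range, List.mem_append, List.mem_map,
      Prod.mk.injEq] at h
    obtain ⟨i, hi, w, hw, a', ha', rfl, rfl⟩ := h
    rcases hw with (⟨j, hj, rfl⟩ | ⟨j, hj, rfl⟩) | ⟨c, hc, j, hj, rfl⟩
    · exact ⟨hj, trivial, ha'⟩
    · exact ⟨hj, trivial, ha'⟩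
    · exact ⟨⟨hc, hj⟩, trivial, ha'⟩
  · rintro ⟨hv, hs, ha⟩
    refine List.mem_flatMap.2 ⟨v.comp, List.mem_range.2 (key _ ha), List.mem_flatMap.2 ⟨v, ?_,
      List.mem_map.2 ⟨a, List.mem_range.2 ha, rfl⟩⟩⟩
    cases v with
    | entry i j =>
      exact List.mem_append_left _ (List.mem_append_left _
        (List.mem_map.2 ⟨j, List.mem_range.2 hv, rfl⟩))
    | inner i j =>
      exact List.mem_append_left _ (List.mem_append_right _
        (List.mem_map.2 ⟨j, List.mem_range.2 hv, rfl⟩))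
    | exit i j => exact hs.elim
    | call i b j => exact hs.elim
    | ret i b j =>
      exact List.mem_append_right _ (List.mem_flatMap.2 ⟨b, List.mem_range.2 hv.1,
        List.mem_map.2 ⟨j, List.mem_range.2 hv.2, rfl⟩⟩)

/-- An RMDP with the finite structure `F`: a transition function and a reward function. Their values
matter only at pairs of a source and an action available there. -/
structure RMDP (F : Frame) where
  δ : Vertex → ℕ → PMF Vertex
  r : Vertex → ℕ → ℝ
  mem_target : ∀ q a, F.IsVertex q → q.IsSource → a < F.numActions q →
    ∀ v ∈ (δ q a).support, F.IsVertex v ∧ v.IsTarget ∧ v.comp = q.comp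

/-! ## Semantics -/

/-- A configuration: the stack of pending calls (each box given by its component and its number
there; top of the stack first) and the current vertex. -/
abbrev State := List (ℕ × ℕ) × Vertex

/-- `F.IsContext κ c`: while the stack is `κ`, the current vertex may be one of component `c`. -/
def Frame.IsContext (F : Frame) : List (ℕ × ℕ) → ℕ → Prop
  | [], _ => True
  | (i, b) :: κ, c => b < (F.comp i).boxes.length ∧ F.callee i b = c ∧ F.IsContext κ i

def Frame.IsState (F : Frame) (s : State) : Prop :=
  F.IsVertex s.2 ∧ F.IsContext s.1 s.2.comp

/-- The stack height: `0` after termination, `1` for the empty stack. -/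
def height : Option State → ℕ
  | none => 0
  | some s => s.1.length + 1

/-- The past of a run: the visited states with the actions chosen there, most recent first. -/
abbrev History := List (State × ℕ)

/-- History-dependent randomized strategies. -/
structure Strategy (F : Frame) where
  choice : History → State → PMF ℕ
  avail : ∀ h s, F.IsState s → ∀ a ∈ (choice h s).support, a < F.numActions s.2

/-- Expectation of a real function under a discrete distribution. -/
def expect {α : Type*} (p : PMF α) (f : α → ℝ) : ℝ := ∑' x, (p x).toReal * f x

namespace RMDP

variable {F : Frame}

/-- One step of the infinite-state MDP; `none` stands for termination. -/
def step (M : RMDP F) : State → ℕ → PMF (Option State)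
  | (κ, .call i b j), _ => PMF.pure (some ((i, b) :: κ, .entry (F.callee i b) j))
  | ([], .exit _ _), _ => PMF.pure none
  | ((i, b) :: κ, .exit _ j), _ => PMF.pure (some (κ, .ret i b j))
  | (κ, v), a => (M.δ v a).map fun v' => some (κ, v')

/-- The reward of one step, which is zero at call ports and exit nodes. -/
def reward (M : RMDP F) (s : State) (a : ℕ) : ℝ := if s.2.IsSource then M.r s.2 a else 0

/-- One step of the process under `σ`, with its past recorded; nothing happens after termination. -/
def advance (M : RMDP F) (σ : Strategy F) :
    History × Option State → PMF (History × Option State)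
  | (h, none) => PMF.pure (h, none)
  | (h, some s) => (σ.choice h s).bind fun a => (M.step s a).map fun t => ((s, a) :: h, t)

/-- The joint law, under `σ` from `s`, of the past and the current state after `k` steps. -/
def run (M : RMDP F) (σ : Strategy F) (s : State) : ℕ → PMF (History × Option State)
  | 0 => PMF.pure ([], some s)
  | k + 1 => (M.run σ s k).bind (M.advance σ)

/-- The probability of still running after `k` steps. -/
def pRun (M : RMDP F) (σ : Strategy F) (s : State) (k : ℕ) : ℝ :=
  expect (M.run σ s k) fun x => if x.2 = none then 0 else 1

/-- The expected stack height after `k` steps. -/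
def expHeight (M : RMDP F) (σ : Strategy F) (s : State) (k : ℕ) : ℝ :=
  expect (M.run σ s k) fun x => (height x.2 : ℝ)

/-- The expected number of steps before termination: the limit of the (increasing) expected numbers
of steps taken up to time `k`. -/
def expSteps (M : RMDP F) (σ : Strategy F) (s : State) : ENNReal :=
  ⨆ k : ℕ, ∑' x, M.run σ s k x * (x.1.length : ENNReal)

/-- The expected reward collected in the first `k` steps. -/
def expReward (M : RMDP F) (σ : Strategy F) (s : State) (k : ℕ) : ℝ :=
  expect (M.run σ s k) fun x => (x.1.map fun y => M.reward y.1 y.2).sum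

/-- The expected total reward of a strategy. -/
def totalReward (M : RMDP F) (σ : Strategy F) (s : State) : ℝ :=
  Filter.limUnder Filter.atTop (M.expReward σ s)

/-- The optimal expected total reward. -/
def optReward (M : RMDP F) (s : State) : ℝ := ⨆ σ : Strategy F, M.totalReward σ s

/-! ## The assumptions -/

/-- `M'` differs from `M` only in the transition function, it is `ε`-close to `M`, and the supports
of its transition distributions are contained in those of `M`. -/
def Close (M : RMDP F) (ε : ℝ) (M' : RMDP F) : Prop :=
  M'.r = M.r ∧
  ∑ x ∈ F.queries.toFinset, ∑' v, |(M.δ x.1 x.2 v).toReal - (M'.δ x.1 x.2 v).toReal| ≤ ε ∧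
  ∀ x ∈ F.queries, (M'.δ x.1 x.2).support ⊆ (M.δ x.1 x.2).support

/-- For every strategy and every state, there is a uniform bound on the expected number of steps
before termination in all `ε`-close RMDPs. -/
def EpsProper (M : RMDP F) (ε : ℝ) : Prop :=
  ∀ σ : Strategy F, ∀ s, F.IsState s → ∃ K : ℝ, ∀ M', M.Close ε M' →
    M'.expSteps σ s ≤ ENNReal.ofReal K

/-- Falling expected stack height, from every vertex with empty stack, for every strategy and every
`ε`-close RMDP. -/
def FallingHeight (M : RMDP F) (ε c₀ μ : ℝ) : Prop :=
  ∀ M', M.Close ε M' → ∀ σ : Strategy F, ∀ q, F.IsVertex q → ∀ k : ℕ,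
    M'.expHeight σ ([], q) k ≤ c₀ - μ * ∑ i ∈ Finset.Icc 1 k, M'.pRun σ ([], q) i

/-- The expected total rewards from all vertices with empty stack, for every strategy and every
`ε`-close RMDP, are bounded by `b` in absolute value. -/
def BoundedReward (M : RMDP F) (ε b : ℝ) : Prop :=
  ∀ M', M.Close ε M' → ∀ σ : Strategy F, ∀ q, F.IsVertex q → |M'.totalReward σ ([], q)| ≤ b

end RMDP

/-! ## Learning -/

/-- One observation of the learner: a sampled source and action, the reading of the reward, and the
successor that was drawn. -/
abbrev Obs := Vertex × ℕ × ℤ × Vertex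

/-- The numerical input of the learner: upper bounds for `c₀`, `1 / μ`, `b`, for the inverse of the
accuracy and for the inverse of the failure probability. -/
structure Params where
  c₀ : ℕ
  invMu : ℕ
  b : ℕ
  invAcc : ℕ
  invConf : ℕ

def paramsEquiv : Params ≃ ℕ × ℕ × ℕ × ℕ × ℕ where
  toFun P := (P.c₀, P.invMu, P.b, P.invAcc, P.invConf)
  invFun x := ⟨x.1, x.2.1, x.2.2.1, x.2.2.2.1, x.2.2.2.2⟩
  left_inv _ := rfl
  right_inv _ := rfl

instance : Primcodable Params := Primcodable.ofEquiv _ paramsEquiv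

def Params.Bounds (P : Params) (c₀ μ b α β : ℝ) : Prop :=
  c₀ ≤ P.c₀ ∧ 1 / μ ≤ P.invMu ∧ b ≤ P.b ∧ 1 / α ≤ P.invAcc ∧ 1 / β ≤ P.invConf

/-- What the learner is given before sampling: the numerical input, the finite structure of the
RMDP, and the initial state. -/
abbrev Input := Params × Frame × State

/-- A learner, which knows neither the transition function nor the reward function. It first fixes
how often every available source-action pair is sampled and how precise the readings of the rewards
are to be (namely `1 / (precision + 1)`), and then turns the observations into a rational number,
given by a numerator `z` and a number `d` that stand for `z / (d + 1)`. -/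
structure Learner where
  samples : Input → ℕ
  precision : Input → ℕ
  output : Input → List Obs → ℤ × ℕ

namespace Learner

/-- The learner is an algorithm. -/
def IsComputable (L : Learner) : Prop :=
  Computable L.samples ∧ Computable L.precision ∧ Computable₂ L.output

def estimate (L : Learner) (I : Input) (D : List Obs) : ℝ :=
  ((L.output I D).1 : ℝ) / ((L.output I D).2 + 1)

end Learner

namespace RMDP

variable {F : Frame}

/-- `ρ q a / (n + 1)` is a reading of the reward `r q a` with error at most `1 / (n + 1)`. -/
def IsReading (M : RMDP F) (n : ℕ) (ρ : Vertex → ℕ → ℤ) : Prop :=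
  ∀ x ∈ F.queries, |(ρ x.1 x.2 : ℝ) / (n + 1) - M.r x.1 x.2| ≤ 1 / (n + 1)

/-- The law of the observations when the given source-action pairs are sampled independently. -/
def observe (M : RMDP F) (ρ : Vertex → ℕ → ℤ) : List (Vertex × ℕ) → PMF (List Obs)
  | [] => PMF.pure []
  | (q, a) :: l => (M.δ q a).bind fun v => (M.observe ρ l).map fun D => (q, a, ρ q a, v) :: D

/-- The law of the observations when every available source-action pair is sampled `N` times. -/
def data (M : RMDP F) (ρ : Vertex → ℕ → ℤ) (N : ℕ) : PMF (List Obs) :=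
  M.observe ρ (F.queries.flatMap (List.replicate N))

end RMDP

end RecMDP

end

/-!
The learner plans on the sampled model: it replaces the transition probabilities by the observed
frequencies and the rewards by their readings, and solves the resulting problem over a finite
horizon `K` by Bellman's recursion, on states with their stacks. Horizon, precision and number of
samples are polynomials in the given bounds and in the size of the frame. Only the model itself
enters the argument, not the models close to it; this matters because the learner does not know
`ε`, and the sampled model need not be `ε`-close.

*Truncation.* Since heights are nonnegative, falling expected height bounds the expected time to
termination from an empty stack by `C = 1 + c₀ / μ`, for all strategies
(`stepsVal_le_of_fallingHeight`); from a state of height `h` it is then at most `C * h`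
(`stepsVal_le`). The rate at which the expected remaining time decays has to be explicit, and a
bound for the first moment alone does not give one. It comes from the sum over time of the expected
stack sizes: this sum equals the expected total time spent inside all calls, so that, from an empty
stack, it is at most `C` times the expected number of calls, hence at most `C ^ 2`
(`stackVal_le_sum`). The expected remaining time after `k` steps is at most `C` times the expected
height at time `k`, and it decreases in `k`; so it is `O(1 / K)` at time `K` (`mul_sum_pRun_le`).
Rewards are at most `2 * b` in absolute value, as differences of total rewards (`abs_r_le`), and
therefore the optimal reward over the horizon `K` differs from the optimal total reward by `O(1 / K)`
(`abs_optReward_sub_val_le`).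

*Sampling.* By Chebyshev's inequality all observed frequencies are close to the probabilities with
high probability (`le_toOuterMeasure_isTypical`). Each of the `K` steps of Bellman's recursion adds a
small error then (`IsTypical.abs_planZ_sub_val_le`).

*Computability.* The recursion is carried out on integers, multiplied by a common denominator. It
calls itself at finitely many states with a smaller horizon, and so it is primitive recursive
(`primrec₂_planZ`).
-/

noncomputable section

namespace RecMDP

/-! ### Expectations under finitely supported distributions -/

theorem expect_eq_sum {α : Type*} {p : PMF α} {s : Finset α} (hs : p.support ⊆ s) (f : α → ℝ) :
    expect p f = ∑ x ∈ s, (p x).toReal * f x := by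
  refine tsum_eq_sum fun x hx => ?_
  have : p x = 0 := by
    by_contra h
    exact hx (hs ((PMF.mem_support_iff _ _).2 h))
  simp [this]

theorem expect_eq_sum_toFinset {α : Type*} {p : PMF α} (hp : p.support.Finite) (f : α → ℝ) :
    expect p f = ∑ x ∈ hp.toFinset, (p x).toReal * f x :=
  expect_eq_sum (by simp) f

theorem sum_toReal_eq_one {α : Type*} {p : PMF α} (hp : p.support.Finite) :
    ∑ x ∈ hp.toFinset, (p x).toReal = 1 := by
  rw [← ENNReal.toReal_sum fun x _ => p.apply_ne_top x]
  have h := p.tsum_coe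
  rw [tsum_eq_sum (s := hp.toFinset)] at h
  · simp [h]
  · intro x hx
    by_contra h
    exact hx (hp.mem_toFinset.2 ((PMF.mem_support_iff _ _).2 h))

theorem expect_const {α : Type*} {p : PMF α} (hp : p.support.Finite) (c : ℝ) :
    expect p (fun _ => c) = c := by
  rw [expect_eq_sum_toFinset hp, ← Finset.sum_mul, sum_toReal_eq_one hp, one_mul]

theorem expect_congr {α : Type*} {p : PMF α} {f g : α → ℝ} (h : ∀ x ∈ p.support, f x = g x) :
    expect p f = expect p g := by
  refine tsum_congr fun x => ?_
  by_cases hx : x ∈ p.support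
  · rw [h x hx]
  · rw [PMF.mem_support_iff, not_not] at hx
    simp [hx]

theorem expect_mono {α : Type*} {p : PMF α} (hp : p.support.Finite) {f g : α → ℝ}
    (h : ∀ x ∈ p.support, f x ≤ g x) : expect p f ≤ expect p g := by
  rw [expect_eq_sum_toFinset hp, expect_eq_sum_toFinset hp]
  refine Finset.sum_le_sum fun x hx => ?_
  exact mul_le_mul_of_nonneg_left (h x (hp.mem_toFinset.1 hx)) ENNReal.toReal_nonneg

theorem expect_add {α : Type*} {p : PMF α} (hp : p.support.Finite) (f g : α → ℝ) :
    expect p (fun x => f x + g x) = expect p f + expect p g := by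
  simp only [expect_eq_sum_toFinset hp, mul_add, Finset.sum_add_distrib]

theorem expect_const_mul {α : Type*} (p : PMF α) (c : ℝ) (f : α → ℝ) :
    expect p (fun x => c * f x) = c * expect p f := by
  unfold expect
  rw [← tsum_mul_left]
  exact tsum_congr fun x => by ring

theorem expect_sub {α : Type*} {p : PMF α} (hp : p.support.Finite) (f g : α → ℝ) :
    expect p (fun x => f x - g x) = expect p f - expect p g := by
  simp only [expect_eq_sum_toFinset hp, mul_sub, Finset.sum_sub_distrib]

theorem expect_sum {α ι : Type*} {p : PMF α} (hp : p.support.Finite) (s : Finset ι)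
    (f : ι → α → ℝ) : expect p (fun x => ∑ i ∈ s, f i x) = ∑ i ∈ s, expect p (f i) := by
  simp only [expect_eq_sum_toFinset hp, Finset.mul_sum]
  exact Finset.sum_comm

theorem expect_list_sum {α ι : Type*} {p : PMF α} (hp : p.support.Finite) (l : List ι)
    (f : ι → α → ℝ) :
    expect p (fun x => (l.map fun i => f i x).sum) = (l.map fun i => expect p (f i)).sum := by
  induction l with
  | nil => simpa using expect_const hp 0
  | cons i l ih => simp only [List.map_cons, List.sum_cons, expect_add hp, ih]

theorem expect_pure {α : Type*} (x : α) (f : α → ℝ) : expect (PMF.pure x) f = f x := by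
  rw [expect_eq_sum (s := {x}) (by simp)]
  simp

theorem finite_support_pure {α : Type*} (x : α) : (PMF.pure x).support.Finite := by simp

theorem finite_support_map {α β : Type*} {p : PMF α} (hp : p.support.Finite) (g : α → β) :
    (p.map g).support.Finite := by
  rw [PMF.support_map]
  exact hp.image _

theorem finite_support_bind {α β : Type*} {p : PMF α} {q : α → PMF β} (hp : p.support.Finite)
    (hq : ∀ x ∈ p.support, (q x).support.Finite) : (p.bind q).support.Finite := by
  rw [PMF.support_bind]
  exact hp.biUnion hq

theorem expect_bind {α β : Type*} {p : PMF α} {q : α → PMF β} (hp : p.support.Finite)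
    (hq : ∀ x ∈ p.support, (q x).support.Finite) (f : β → ℝ) :
    expect (p.bind q) f = expect p fun x => expect (q x) f := by
  have hb := finite_support_bind hp hq
  have hsub : ∀ x ∈ hp.toFinset, (q x).support ⊆ hb.toFinset := by
    intro x hx y hy
    simp only [Set.Finite.coe_toFinset, PMF.mem_support_bind_iff]
    exact ⟨x, hp.mem_toFinset.1 hx, hy⟩
  rw [expect_eq_sum_toFinset hb, expect_eq_sum_toFinset hp]
  have h1 : ∀ y, ((p.bind q) y).toReal = ∑ x ∈ hp.toFinset, (p x).toReal * (q x y).toReal := by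
    intro y
    rw [PMF.bind_apply, tsum_eq_sum (s := hp.toFinset), ENNReal.toReal_sum]
    · simp
    · exact fun x _ => ENNReal.mul_ne_top (p.apply_ne_top x) ((q x).apply_ne_top y)
    · intro x hx
      have : p x = 0 := by
        by_contra h
        exact hx (hp.mem_toFinset.2 ((PMF.mem_support_iff _ _).2 h))
      simp [this]
  simp only [h1, Finset.sum_mul]
  rw [Finset.sum_comm]
  refine Finset.sum_congr rfl fun x hx => ?_
  rw [expect_eq_sum (hsub x hx), Finset.mul_sum]
  exact Finset.sum_congr rfl fun y _ => by ring

theorem expect_map {α β : Type*} {p : PMF α} (hp : p.support.Finite) (g : α → β) (f : β → ℝ) :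
    expect (p.map g) f = expect p fun x => f (g x) := by
  rw [← PMF.bind_pure_comp, expect_bind hp fun x _ => by simp]
  simp [expect_pure]

theorem expect_nonneg {α : Type*} {p : PMF α} {f : α → ℝ} (h : ∀ x ∈ p.support, 0 ≤ f x) :
    0 ≤ expect p f := by
  refine tsum_nonneg fun x => ?_
  by_cases hx : x ∈ p.support
  · exact mul_nonneg ENNReal.toReal_nonneg (h x hx)
  · rw [PMF.mem_support_iff, not_not] at hx
    simp [hx]

theorem abs_expect_le {α : Type*} {p : PMF α} (hp : p.support.Finite) {f : α → ℝ} {c : ℝ}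
    (h : ∀ x ∈ p.support, |f x| ≤ c) : |expect p f| ≤ c := by
  rw [abs_le]
  constructor
  · rw [← expect_const hp (-c)]
    exact expect_mono hp fun x hx => (abs_le.1 (h x hx)).1
  · rw [← expect_const hp c]
    exact expect_mono hp fun x hx => (abs_le.1 (h x hx)).2

/-! ### Valid states and the one-step distribution -/

namespace Frame

/-- The inner nodes, exit nodes and call ports of all components. -/
def targets (F : Frame) : List Vertex :=
  (List.range F.length).flatMap fun i =>
    (List.range (F.comp i).inners).map (.inner i) ++
    (List.range (F.comp i).exits).map (.exit i) ++
    (List.range (F.comp i).boxes.length).flatMap fun b =>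
      (List.range (F.comp (F.callee i b)).entries).map (.call i b)

theorem comp_lt_length {F : Frame} {v : Vertex} (hv : F.IsVertex v) : v.comp < F.length := by
  by_contra h
  have h0 := F.comp_of_le (not_lt.1 h)
  cases v <;> simp only [Vertex.comp] at h0 <;> simp only [IsVertex, h0] at hv
  · exact Nat.not_lt_zero _ hv
  · exact Nat.not_lt_zero _ hv
  · exact Nat.not_lt_zero _ hv
  · exact Nat.not_lt_zero _ hv.1
  · exact Nat.not_lt_zero _ hv.1

theorem mem_targets {F : Frame} {v : Vertex} (hv : F.IsVertex v) (ht : v.IsTarget) :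
    v ∈ F.targets := by
  refine List.mem_flatMap.2 ⟨v.comp, List.mem_range.2 (comp_lt_length hv), ?_⟩
  cases v with
  | entry i j => exact ht.elim
  | inner i j =>
    exact List.mem_append_left _ (List.mem_append_left _
      (List.mem_map.2 ⟨j, List.mem_range.2 hv, rfl⟩))
  | exit i j =>
    exact List.mem_append_left _ (List.mem_append_right _
      (List.mem_map.2 ⟨j, List.mem_range.2 hv, rfl⟩))
  | call i b j =>
    exact List.mem_append_right _ (List.mem_flatMap.2 ⟨b, List.mem_range.2 hv.1,
      List.mem_map.2 ⟨j, List.mem_range.2 hv.2, rfl⟩⟩)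
  | ret i b j => exact ht.elim

theorem WF.numActions_pos {F : Frame} (hF : F.WF) {v : Vertex} (hv : F.IsVertex v) :
    0 < F.numActions v := by
  have h := comp_lt_length hv
  have : F.comp v.comp ∈ F := by
    unfold comp
    rw [List.getD_eq_getElem _ _ h]
    exact List.getElem_mem h
  exact (hF _ this).1

/-- States of the process, termination included. -/
def IsOptState (F : Frame) : Option State → Prop
  | none => True
  | some s => F.IsState s

theorem isState_nil {F : Frame} {q : Vertex} (hq : F.IsVertex q) : F.IsState ([], q) :=
  ⟨hq, trivial⟩

theorem IsState.call {F : Frame} {κ : List (ℕ × ℕ)} {i b j : ℕ}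
    (h : F.IsState (κ, .call i b j)) : F.IsState ((i, b) :: κ, .entry (F.callee i b) j) :=
  ⟨h.1.2, h.1.1, rfl, h.2⟩

theorem IsState.exit {F : Frame} {κ : List (ℕ × ℕ)} {i b c j : ℕ}
    (h : F.IsState ((i, b) :: κ, .exit c j)) : F.IsState (κ, .ret i b j) := by
  obtain ⟨h1, h2, h3, h4⟩ := h
  simp only [Vertex.comp] at h3
  exact ⟨⟨h2, by rw [h3]; exact h1⟩, h4⟩

/-- The stack above a given level of a stack is again a stack. -/
theorem IsContext.take {F : Frame} (m : ℕ) : ∀ {κ : List (ℕ × ℕ)} {c : ℕ},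
    F.IsContext κ c → F.IsContext (κ.take m) c := by
  induction m with
  | zero => intro κ c _; simp [IsContext]
  | succ m ih =>
    intro κ c h
    cases κ with
    | nil => trivial
    | cons p κ => exact ⟨h.1, h.2.1, ih h.2.2⟩

theorem IsState.take {F : Frame} (m : ℕ) {κ : List (ℕ × ℕ)} {q : Vertex}
    (h : F.IsState (κ, q)) : F.IsState (κ.take m, q) :=
  ⟨h.1, IsContext.take m h.2⟩

end Frame

namespace RMDP

variable {F : Frame}

theorem step_source (M : RMDP F) {q : Vertex} (hq : q.IsSource) (κ : List (ℕ × ℕ)) (a : ℕ) :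
    M.step (κ, q) a = (M.δ q a).map fun v => some (κ, v) := by
  cases q with
  | entry i j => cases κ <;> rfl
  | inner i j => cases κ <;> rfl
  | ret i b j => cases κ <;> rfl
  | exit i j => exact hq.elim
  | call i b j => exact hq.elim

theorem finite_support_δ (M : RMDP F) {q : Vertex} {a : ℕ} (h1 : F.IsVertex q) (h2 : q.IsSource)
    (h3 : a < F.numActions q) : (M.δ q a).support.Finite := by
  refine (F.targets.toFinset.finite_toSet).subset fun v hv => ?_
  have := M.mem_target q a h1 h2 h3 v hv
  simpa using Frame.mem_targets this.1 this.2.1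

theorem finite_support_step (M : RMDP F) {s : State} {a : ℕ} (hs : F.IsState s)
    (ha : a < F.numActions s.2) : (M.step s a).support.Finite := by
  obtain ⟨κ, q⟩ := s
  by_cases hq : q.IsSource
  · rw [step_source M hq]
    exact finite_support_map (M.finite_support_δ hs.1 hq ha) _
  · cases q with
    | entry i j => exact absurd trivial hq
    | inner i j => exact absurd trivial hq
    | ret i b j => exact absurd trivial hq
    | exit i j => cases κ <;> exact finite_support_pure _
    | call i b j => cases κ <;> exact finite_support_pure _

theorem isOptState_of_mem_support_step (M : RMDP F) {s : State} {a : ℕ} (hs : F.IsState s)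
    (ha : a < F.numActions s.2) {t : Option State} (ht : t ∈ (M.step s a).support) :
    F.IsOptState t := by
  obtain ⟨κ, q⟩ := s
  by_cases hq : q.IsSource
  · rw [step_source M hq, PMF.support_map] at ht
    obtain ⟨v, hv, rfl⟩ := ht
    obtain ⟨h1, -, h3⟩ := M.mem_target q a hs.1 hq ha v hv
    refine ⟨h1, ?_⟩
    simpa only [h3] using hs.2
  · cases q with
    | entry i j => exact absurd trivial hq
    | inner i j => exact absurd trivial hq
    | ret i b j => exact absurd trivial hq
    | exit i j =>
      cases κ with
      | nil =>
        rw [step, PMF.mem_support_pure_iff] at ht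
        subst ht
        trivial
      | cons p κ =>
        rw [step, PMF.mem_support_pure_iff] at ht
        subst ht
        exact hs.exit
    | call i b j =>
      have ht' : t = some ((i, b) :: κ, .entry (F.callee i b) j) := by
        cases κ <;> rwa [step, PMF.mem_support_pure_iff] at ht
      subst ht'
      exact hs.call

/-! ### Finite-horizon dynamic programming -/

/-- The maximal expected total of the one-step gains `g` over a finite horizon, by Bellman's
recursion. At valid states there is an action, so that the supremum is a maximum. -/
def val (M : RMDP F) (g : State → ℕ → ℝ) : ℕ → Option State → ℝ
  | 0, _ => 0
  | _ + 1, none => 0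
  | n + 1, some x => ⨆ a : Fin (F.numActions x.2), (g x a + expect (M.step x a) (M.val g n))

variable (M : RMDP F) (g : State → ℕ → ℝ)

@[simp] theorem val_zero (t : Option State) : M.val g 0 t = 0 := rfl

@[simp] theorem val_none (n : ℕ) : M.val g n none = 0 := by cases n <;> rfl

theorem le_val_succ (n : ℕ) (x : State) {a : ℕ} (ha : a < F.numActions x.2) :
    g x a + expect (M.step x a) (M.val g n) ≤ M.val g (n + 1) (some x) :=
  le_ciSup (f := fun a : Fin (F.numActions x.2) => g x a + expect (M.step x a) (M.val g n))
    (Set.finite_range _).bddAbove ⟨a, ha⟩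

theorem val_succ_le (hF : F.WF) (n : ℕ) {x : State} (hx : F.IsState x) {c : ℝ}
    (h : ∀ a < F.numActions x.2, g x a + expect (M.step x a) (M.val g n) ≤ c) :
    M.val g (n + 1) (some x) ≤ c := by
  have : Nonempty (Fin (F.numActions x.2)) := ⟨⟨0, hF.numActions_pos hx.1⟩⟩
  exact ciSup_le fun a => h a a.2

theorem exists_val_succ_eq (hF : F.WF) (n : ℕ) {x : State} (hx : F.IsState x) :
    ∃ a < F.numActions x.2, M.val g (n + 1) (some x) = g x a + expect (M.step x a) (M.val g n) := by
  have : Nonempty (Fin (F.numActions x.2)) := ⟨⟨0, hF.numActions_pos hx.1⟩⟩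
  obtain ⟨a, ha⟩ := exists_eq_ciSup_of_finite
    (f := fun a : Fin (F.numActions x.2) => g x a + expect (M.step x a) (M.val g n))
  exact ⟨a, a.2, ha.symm⟩

/-! ### The law of a run -/

/-- The total of the one-step gains `g` along the past of a run. -/
def gain (g : State → ℕ → ℝ) (h : History) : ℝ := (h.map fun y => g y.1 y.2).sum

@[simp] theorem gain_nil : gain g [] = 0 := rfl

@[simp] theorem gain_cons (x : State) (a : ℕ) (h : History) :
    gain g ((x, a) :: h) = g x a + gain g h := by simp [gain]

variable (σ : Strategy F)

theorem finite_support_choice (h : History) {s : State} (hs : F.IsState s) :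
    (σ.choice h s).support.Finite :=
  (Set.finite_lt_nat (F.numActions s.2)).subset fun a ha => σ.avail h s hs a ha

theorem finite_support_advance {x : History × Option State} (hx : F.IsOptState x.2) :
    (M.advance σ x).support.Finite := by
  obtain ⟨h, _ | s⟩ := x
  · exact finite_support_pure _
  · exact finite_support_bind (finite_support_choice σ h hx) fun a ha =>
      finite_support_map (M.finite_support_step hx (σ.avail h s hx a ha)) _

theorem expect_advance_some (h : History) {s : State} (hs : F.IsState s)
    (f : History × Option State → ℝ) :
    expect (M.advance σ (h, some s)) f =
      expect (σ.choice h s) fun a => expect (M.step s a) fun t => f ((s, a) :: h, t) := by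
  rw [advance, expect_bind (finite_support_choice σ h hs) fun a ha =>
    finite_support_map (M.finite_support_step hs (σ.avail h s hs a ha)) _]
  exact expect_congr fun a ha => expect_map (M.finite_support_step hs (σ.avail h s hs a ha)) _ _

theorem expect_advance_none (h : History) (f : History × Option State → ℝ) :
    expect (M.advance σ (h, none)) f = f (h, none) := by
  rw [advance, expect_pure]

/-- What is known of the history and the current state after `k` steps. -/
structure IsOutcome (F : Frame) (k : ℕ) (x : History × Option State) : Prop where
  state : F.IsOptState x.2
  length_le : x.1.length ≤ k
  length_eq : x.2 ≠ none → x.1.length = k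
  past : ∀ y ∈ x.1, F.IsState y.1 ∧ y.2 < F.numActions y.1.2

variable {s : State}

theorem isOutcome_of_mem_support_run (hs : F.IsState s) (k : ℕ) :
    ∀ x ∈ (M.run σ s k).support, IsOutcome F k x := by
  induction k with
  | zero =>
    intro x hx
    rw [run, PMF.mem_support_pure_iff] at hx
    subst hx
    exact ⟨hs, le_rfl, fun _ => rfl, by simp⟩
  | succ k ih =>
    intro x hx
    rw [run, PMF.mem_support_bind_iff] at hx
    obtain ⟨⟨h, y⟩, hy, hx⟩ := hx
    obtain ⟨h1, h2, h3, h4⟩ := ih _ hy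
    cases y with
    | none =>
      rw [advance, PMF.mem_support_pure_iff] at hx
      subst hx
      exact ⟨trivial, h2.trans k.le_succ, fun h => absurd rfl h, h4⟩
    | some y =>
      rw [advance, PMF.mem_support_bind_iff] at hx
      obtain ⟨a, ha, hx⟩ := hx
      rw [PMF.support_map] at hx
      obtain ⟨t, ht, rfl⟩ := hx
      have ha' := σ.avail h y h1 a ha
      have h3' := h3 (by simp)
      refine ⟨M.isOptState_of_mem_support_step h1 ha' ht, ?_, fun _ => ?_, ?_⟩
      · simpa using h2
      · simpa using h3'
      · intro z hz
        rcases List.mem_cons.1 hz with rfl | hz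
        · exact ⟨h1, ha'⟩
        · exact h4 z hz

theorem finite_support_run (hs : F.IsState s) (k : ℕ) : (M.run σ s k).support.Finite := by
  induction k with
  | zero => exact finite_support_pure _
  | succ k ih =>
    exact finite_support_bind ih fun x hx =>
      M.finite_support_advance σ (M.isOutcome_of_mem_support_run σ hs k x hx).state

theorem expect_run_succ (hs : F.IsState s) (k : ℕ) (f : History × Option State → ℝ) :
    expect (M.run σ s (k + 1)) f = expect (M.run σ s k) fun x => expect (M.advance σ x) f :=
  expect_bind (M.finite_support_run σ hs k) (fun x hx =>
      M.finite_support_advance σ (M.isOutcome_of_mem_support_run σ hs k x hx).state) f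

/-- No strategy gains more than the value of the finite-horizon problem: the gain so far plus the
value of what remains decreases in expectation. -/
theorem expect_gain_add_val_le (hs : F.IsState s) (n k : ℕ) :
    expect (M.run σ s (k + n)) (fun x => gain g x.1) ≤
      expect (M.run σ s k) fun x => gain g x.1 + M.val g n x.2 := by
  induction n generalizing k with
  | zero => simp
  | succ n ih =>
    have h1 := ih (k + 1)
    rw [show k + 1 + n = k + (n + 1) by ring] at h1
    refine h1.trans ?_
    rw [M.expect_run_succ σ hs]
    refine expect_mono (M.finite_support_run σ hs k) ?_
    rintro ⟨h, _ | y⟩ hy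
    · simp [expect_advance_none]
    · have hy' := (M.isOutcome_of_mem_support_run σ hs k _ hy).state
      have hfin := finite_support_choice σ h hy'
      rw [M.expect_advance_some σ h hy']
      refine le_trans (expect_mono hfin (g := fun _ => gain g h + M.val g (n + 1) (some y))
        fun a ha => ?_) (expect_const hfin _).le
      have ha' := σ.avail h y hy' a ha
      have hst := M.finite_support_step hy' ha'
      have h2 := M.le_val_succ g n y ha'
      simp only [gain_cons]
      rw [expect_add hst, expect_const hst]
      linarith

theorem expect_gain_le_val (hs : F.IsState s) (n : ℕ) :
    expect (M.run σ s n) (fun x => gain g x.1) ≤ M.val g n (some s) := by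
  have h := M.expect_gain_add_val_le g σ hs n 0
  simpa [run, expect_pure] using h

/-- The value of the finite-horizon problem is attained, namely by the strategy that plays an
optimal action for the remaining number of steps. -/
theorem exists_expect_gain_eq_val (hF : F.WF) (n : ℕ) :
    ∃ σ : Strategy F, ∀ s, F.IsState s →
      expect (M.run σ s n) (fun x => gain g x.1) = M.val g n (some s) := by
  choose! act hact using fun (m : ℕ) (x : State) (hx : F.IsState x) =>
    M.exists_val_succ_eq g hF m hx
  let σ : Strategy F :=
    { choice := fun h x => PMF.pure (act (n - h.length - 1) x)
      avail := by
        intro h x hx a ha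
        rw [PMF.mem_support_pure_iff] at ha
        subst ha
        exact (hact _ x hx).1 }
  refine ⟨σ, fun s hs => ?_⟩
  have key : ∀ k ≤ n, expect (M.run σ s k) (fun x => gain g x.1 + M.val g (n - k) x.2) =
      M.val g n (some s) := by
    intro k
    induction k with
    | zero => intro _; simp [run, expect_pure]
    | succ k ih =>
      intro hk
      rw [← ih (by omega), M.expect_run_succ σ hs]
      refine expect_congr ?_
      rintro ⟨h, _ | y⟩ hy
      · simp [expect_advance_none]
      · have ho := M.isOutcome_of_mem_support_run σ hs k _ hy
        have hlen : h.length = k := ho.length_eq (by simp)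
        obtain ⟨h1, h2⟩ := hact (n - (k + 1)) y ho.state
        rw [M.expect_advance_some σ h ho.state]
        have hst := M.finite_support_step ho.state h1
        have hc : σ.choice h y = PMF.pure (act (n - (k + 1)) y) := by
          simp only [σ, hlen]
          rw [Nat.sub_sub]
        rw [hc, expect_pure]
        simp only [gain_cons]
        rw [expect_add hst, expect_const hst, show n - k = n - (k + 1) + 1 by omega, h2]
        ring
  simpa using key n le_rfl

end RMDP

namespace RMDP

variable {F : Frame} (M : RMDP F)

/-! ### The expected time to termination -/

theorem not_isSource_iff {q : Vertex} :
    ¬ q.IsSource ↔ (∃ i b j, q = .call i b j) ∨ ∃ i j, q = .exit i j := by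
  cases q <;> simp [Vertex.IsSource]

theorem step_call (κ : List (ℕ × ℕ)) (i b j a : ℕ) :
    M.step (κ, .call i b j) a = PMF.pure (some ((i, b) :: κ, .entry (F.callee i b) j)) := by
  cases κ <;> rfl

theorem val_succ_of_step_eq_pure (hF : F.WF) (g : State → ℕ → ℝ) (n : ℕ) {x : State}
    (hx : F.IsState x) {c : ℝ} {t : Option State} (hg : ∀ a, g x a = c)
    (ht : ∀ a, M.step x a = PMF.pure t) : M.val g (n + 1) (some x) = c + M.val g n t := by
  obtain ⟨a, -, h⟩ := M.exists_val_succ_eq g hF n hx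
  rw [h, hg, ht, expect_pure]

theorem expect_step_source {q : Vertex} {κ : List (ℕ × ℕ)} {a : ℕ} (hs : F.IsVertex q)
    (hq : q.IsSource) (ha : a < F.numActions q) (f : Option State → ℝ) :
    expect (M.step (κ, q) a) f = expect (M.δ q a) fun v => f (some (κ, v)) := by
  rw [step_source M hq, expect_map (M.finite_support_δ hs hq ha)]

theorem isState_of_mem_support_δ {q : Vertex} {κ : List (ℕ × ℕ)} {a : ℕ} (hs : F.IsState (κ, q))
    (hq : q.IsSource) (ha : a < F.numActions q) {v : Vertex} (hv : v ∈ (M.δ q a).support) :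
    F.IsState (κ, v) := by
  obtain ⟨h1, -, h3⟩ := M.mem_target q a hs.1 hq ha v hv
  refine ⟨h1, ?_⟩
  simpa only [h3] using hs.2

/-- The maximal expected number of steps taken within a finite horizon. -/
abbrev stepsVal : ℕ → Option State → ℝ := M.val fun _ _ => 1

/-- The maximal expected total of the stack sizes within a finite horizon. -/
abbrev stackVal : ℕ → Option State → ℝ := M.val fun x _ => (x.1.length : ℝ)

/-- Pending calls below the current frame cost at most what can be spent after the frame is
left. -/
theorem stepsVal_append_le (hF : F.WF) {i b : ℕ} {κ' : List (ℕ × ℕ)} {B : ℝ} (hB0 : 0 ≤ B)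
    (hB : ∀ n j, F.IsState (κ', .ret i b j) → M.stepsVal n (some (κ', .ret i b j)) ≤ B) (n : ℕ) :
    ∀ κ q, F.IsState (κ, q) → F.IsState (κ ++ (i, b) :: κ', q) →
      M.stepsVal n (some (κ ++ (i, b) :: κ', q)) ≤ M.stepsVal n (some (κ, q)) + B := by
  induction n with
  | zero => intro κ q _ _; simpa using hB0
  | succ n ih =>
    intro κ q h1 h2
    by_cases hq : q.IsSource
    · refine M.val_succ_le _ hF n h2 fun a ha => ?_
      have hfin := M.finite_support_δ h1.1 hq ha
      have h3 := M.le_val_succ (fun _ _ => 1) n (κ, q) ha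
      rw [M.expect_step_source h1.1 hq ha] at h3 ⊢
      have h4 : expect (M.δ q a) (fun v => M.stepsVal n (some (κ ++ (i, b) :: κ', v))) ≤
          expect (M.δ q a) fun v => M.stepsVal n (some (κ, v)) + B :=
        expect_mono hfin fun v hv => ih κ v (M.isState_of_mem_support_δ h1 hq ha hv)
          (M.isState_of_mem_support_δ h2 hq ha hv)
      rw [expect_add hfin, expect_const hfin] at h4
      linarith
    · rcases not_isSource_iff.1 hq with ⟨i', b', j, rfl⟩ | ⟨i', j, rfl⟩
      · rw [stepsVal, M.val_succ_of_step_eq_pure hF _ n h2 (fun _ => rfl) (M.step_call _ _ _ _),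
          M.val_succ_of_step_eq_pure hF _ n h1 (fun _ => rfl) (M.step_call _ _ _ _)]
        have := ih _ _ h1.call h2.call
        rw [List.cons_append] at this
        linarith
      · cases κ with
        | nil =>
          rw [stepsVal, List.nil_append] at *
          rw [M.val_succ_of_step_eq_pure hF _ n h2 (fun _ => rfl) (fun _ => rfl),
            M.val_succ_of_step_eq_pure hF _ n h1 (fun _ => rfl) (fun _ => rfl), val_none]
          have := hB n j h2.exit
          linarith
        | cons p κ =>
          rw [stepsVal, List.cons_append] at *
          rw [M.val_succ_of_step_eq_pure hF _ n h2 (fun _ => rfl) (fun _ => rfl),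
            M.val_succ_of_step_eq_pure hF _ n h1 (fun _ => rfl) (fun _ => rfl)]
          have := ih _ _ h1.exit h2.exit
          linarith

section bounds

variable {C : ℝ} (hC1 : 1 ≤ C)
  (hC : ∀ n q, F.IsVertex q → M.stepsVal n (some ([], q)) ≤ C)

include hC1 hC

theorem stepsVal_le (hF : F.WF) (n : ℕ) (κ : List (ℕ × ℕ)) :
    ∀ q, F.IsState (κ, q) → M.stepsVal n (some (κ, q)) ≤ C * (κ.length + 1) := by
  induction κ generalizing n with
  | nil => intro q hq; simpa using hC n q hq.1
  | cons p κ ih =>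
    intro q hq
    have h := M.stepsVal_append_le hF (i := p.1) (b := p.2) (κ' := κ) (B := C * (κ.length + 1))
      (by positivity) (fun m j hj => ih m _ hj) n [] q (Frame.isState_nil hq.1) hq
    have h2 := hC n q hq.1
    simp only [List.nil_append, Prod.mk.eta] at h
    push_cast [List.length_cons]
    linarith

/-- A unit of stack size at some time is a time step spent inside one of the calls then pending.
Hence the total stack size is the sum, over all calls, of the time spent inside the call. A call
made later starts from an empty stack of its own, so it contributes at most `C`, and there are at
most as many of these as there are steps; the calls already pending contribute the sum. -/
theorem stackVal_le_sum (hF : F.WF) (n : ℕ) :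
    ∀ κ q, F.IsState (κ, q) → M.stackVal n (some (κ, q)) ≤
      C * M.stepsVal n (some (κ, q)) +
        ∑ i ∈ Finset.range κ.length, M.stepsVal n (some (κ.take i, q)) := by
  have hC0 : 0 ≤ C := zero_le_one.trans hC1
  induction n with
  | zero => intro κ q _; simp
  | succ n ih =>
    intro κ q hs
    by_cases hq : q.IsSource
    · refine M.val_succ_le _ hF n hs fun a ha => ?_
      have hfin := M.finite_support_δ hs.1 hq ha
      have h1 := M.le_val_succ (fun _ _ => 1) n (κ, q) ha
      have h2 : ∑ i ∈ Finset.range κ.length,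
          (1 + expect (M.δ q a) fun v => M.stepsVal n (some (κ.take i, v))) ≤
          ∑ i ∈ Finset.range κ.length, M.stepsVal (n + 1) (some (κ.take i, q)) := by
        refine Finset.sum_le_sum fun i _ => ?_
        have := M.le_val_succ (fun _ _ => 1) n (κ.take i, q) ha
        rwa [M.expect_step_source hs.1 hq ha] at this
      rw [M.expect_step_source hs.1 hq ha] at h1 ⊢
      have h3 := expect_mono hfin fun v hv => ih κ v (M.isState_of_mem_support_δ hs hq ha hv)
      rw [expect_add hfin, expect_const_mul, expect_sum hfin] at h3
      rw [Finset.sum_add_distrib] at h2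
      simp only [Finset.sum_const, Finset.card_range, nsmul_eq_mul, mul_one] at h2
      have h4 := mul_le_mul_of_nonneg_left h1 hC0
      rw [mul_add, mul_one] at h4
      dsimp only [stepsVal, stackVal] at *
      linarith
    · rcases not_isSource_iff.1 hq with ⟨i', b', j, rfl⟩ | ⟨i', j, rfl⟩
      · have h1 := ih _ _ hs.call
        rw [List.length_cons, Finset.sum_range_succ'] at h1
        simp only [List.take_succ_cons, List.take_zero] at h1
        have h2 : ∀ i ∈ Finset.range κ.length,
            M.stepsVal (n + 1) (some (κ.take i, .call i' b' j)) =
            1 + M.stepsVal n (some ((i', b') :: κ.take i, .entry (F.callee i' b') j)) :=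
          fun i _ => M.val_succ_of_step_eq_pure hF _ n (hs.take i) (fun _ => rfl)
            (M.step_call _ _ _ _)
        rw [Finset.sum_congr rfl h2, Finset.sum_add_distrib, stackVal, stepsVal,
          M.val_succ_of_step_eq_pure hF _ n hs (fun _ => rfl) (M.step_call _ _ _ _),
          M.val_succ_of_step_eq_pure hF _ n hs (fun _ => rfl) (M.step_call _ _ _ _)]
        simp only [Finset.sum_const, Finset.card_range, nsmul_eq_mul, mul_one]
        have h3 := hC n _ hs.call.1
        dsimp only [stepsVal, stackVal] at *
        linarith
      · cases κ with
        | nil =>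
          rw [stackVal, stepsVal,
            M.val_succ_of_step_eq_pure hF _ n hs (fun _ => rfl) (fun _ => rfl),
            M.val_succ_of_step_eq_pure hF _ n hs (fun _ => rfl) (fun _ => rfl)]
          simpa using hC0
        | cons p κ =>
          have h1 := ih _ _ hs.exit
          have h2 : ∀ i ∈ Finset.range κ.length,
              M.stepsVal (n + 1) (some ((p :: κ).take (i + 1), .exit i' j)) =
              1 + M.stepsVal n (some (κ.take i, .ret p.1 p.2 j)) :=
            fun i _ => M.val_succ_of_step_eq_pure hF _ n (hs.take (i + 1)) (fun _ => rfl)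
              (fun _ => rfl)
          rw [List.length_cons, Finset.sum_range_succ', Finset.sum_congr rfl h2,
            Finset.sum_add_distrib, stackVal, stepsVal, List.take_zero,
            M.val_succ_of_step_eq_pure hF _ n hs (fun _ => rfl) (fun _ => rfl),
            M.val_succ_of_step_eq_pure hF _ n hs (fun _ => rfl) (fun _ => rfl),
            M.val_succ_of_step_eq_pure hF _ n (Frame.isState_nil hs.1) (fun _ => rfl)
              (fun _ => rfl)]
          simp only [Finset.sum_const, Finset.card_range, nsmul_eq_mul, mul_one, val_none,
            List.length_cons, Nat.cast_add, Nat.cast_one]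
          dsimp only [stepsVal, stackVal] at *
          linarith

theorem stackVal_le (hF : F.WF) (n : ℕ) {κ : List (ℕ × ℕ)} {q : Vertex} (hs : F.IsState (κ, q)) :
    M.stackVal n (some (κ, q)) ≤ 2 * C ^ 2 * (κ.length + 1) ^ 2 := by
  have h1 := M.stackVal_le_sum hC1 hC hF n κ q hs
  have h2 : ∑ i ∈ Finset.range κ.length, M.stepsVal n (some (κ.take i, q)) ≤
      ∑ i ∈ Finset.range κ.length, C * (κ.length + 1) := by
    refine Finset.sum_le_sum fun i _ => (M.stepsVal_le hC1 hC hF n _ q (hs.take i)).trans ?_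
    have : (κ.take i).length ≤ κ.length := by simp
    have : ((κ.take i).length : ℝ) ≤ κ.length := by exact_mod_cast this
    gcongr
  have h3 := M.stepsVal_le hC1 hC hF n κ q hs
  simp only [Finset.sum_const, Finset.card_range, nsmul_eq_mul] at h2
  have hk : (0 : ℝ) ≤ κ.length := Nat.cast_nonneg _
  generalize (κ.length : ℝ) = k at *
  have h4 : C * M.stepsVal n (some (κ, q)) ≤ C * (C * (k + 1)) := by gcongr
  have h5 : C * (C * (k + 1)) ≤ C ^ 2 * (k + 1) ^ 2 := by
    have : k + 1 ≤ (k + 1) ^ 2 := by nlinarith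
    nlinarith [sq_nonneg C]
  have h6 : k * (C * (k + 1)) ≤ C ^ 2 * (k + 1) ^ 2 := by
    have : C ≤ C ^ 2 := by nlinarith
    have h7 : k * (k + 1) ≤ (k + 1) ^ 2 := by nlinarith
    calc k * (C * (k + 1)) = C * (k * (k + 1)) := by ring
      _ ≤ C ^ 2 * (k + 1) ^ 2 := by gcongr
  linarith

end bounds

/-! ### The decay of the survival probability -/

variable {σ : Strategy F} {s : State}

/-- Expected gains that do not depend on the actions add up over the time steps. -/
theorem expect_gain_eq_sum (hs : F.IsState s) (c : State → ℝ) (n : ℕ) :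
    expect (M.run σ s n) (fun x => gain (fun y _ => c y) x.1) =
      ∑ k ∈ Finset.range n, expect (M.run σ s k) fun x => x.2.elim 0 c := by
  induction n with
  | zero => simp [run, expect_pure]
  | succ n ih =>
    rw [Finset.sum_range_succ, ← ih, ← expect_add (M.finite_support_run σ hs n),
      M.expect_run_succ σ hs]
    refine expect_congr ?_
    rintro ⟨h, _ | y⟩ hy
    · simp [expect_advance_none]
    · have hy' := (M.isOutcome_of_mem_support_run σ hs n _ hy).state
      have hfin := finite_support_choice σ h hy'
      rw [M.expect_advance_some σ h hy']
      simp only [gain_cons]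
      rw [expect_congr (g := fun _ => c y + gain (fun y _ => c y) h) fun a ha =>
        expect_const (M.finite_support_step hy' (σ.avail h y hy' a ha)) _, expect_const hfin]
      simp [add_comm]

theorem pRun_eq (k : ℕ) :
    M.pRun σ s k = expect (M.run σ s k) fun x => x.2.elim 0 fun _ => 1 := by
  refine congrArg _ (funext fun x => ?_)
  rcases x with ⟨h, _ | y⟩ <;> simp

theorem expHeight_eq (hs : F.IsState s) (k : ℕ) :
    M.expHeight σ s k = expect (M.run σ s k) (fun x => x.2.elim 0 fun y => (y.1.length : ℝ)) +
      M.pRun σ s k := by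
  rw [pRun_eq, ← expect_add (M.finite_support_run σ hs k)]
  refine congrArg _ (funext fun x => ?_)
  rcases x with ⟨h, _ | y⟩ <;> simp [height]

theorem pRun_nonneg (k : ℕ) : 0 ≤ M.pRun σ s k :=
  expect_nonneg fun x _ => by split_ifs <;> simp

theorem expHeight_nonneg (k : ℕ) : 0 ≤ M.expHeight σ s k :=
  expect_nonneg fun _ _ => Nat.cast_nonneg _

theorem close_refl {ε : ℝ} (hε : 0 ≤ ε) : M.Close ε M :=
  ⟨rfl, by simpa using hε, fun _ _ => subset_rfl⟩

/-- Falling expected stack height bounds the expected time to termination, uniformly over all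
strategies. -/
theorem stepsVal_le_of_fallingHeight (hF : F.WF) {ε c₀ μ : ℝ} (hε : 0 ≤ ε) (hμ : 0 < μ)
    (h : M.FallingHeight ε c₀ μ) (n : ℕ) {q : Vertex} (hq : F.IsVertex q) :
    M.stepsVal n (some ([], q)) ≤ 1 + c₀ / μ := by
  obtain ⟨σ, hσ⟩ := M.exists_expect_gain_eq_val (fun _ _ => 1) hF n
  have hs : F.IsState ([], q) := Frame.isState_nil hq
  rw [stepsVal, ← hσ _ hs, M.expect_gain_eq_sum hs (fun _ => 1)]
  have h1 := h M (M.close_refl hε) σ q hq n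
  have h2 : 0 ≤ M.expHeight σ ([], q) n := M.expHeight_nonneg n
  have h3 : ∑ i ∈ Finset.Icc 1 n, M.pRun σ ([], q) i ≤ c₀ / μ := by
    rw [le_div_iff₀ hμ]
    linarith
  have h4 : ∑ k ∈ Finset.range n, M.pRun σ ([], q) k ≤
      ∑ k ∈ Finset.range (n + 1), M.pRun σ ([], q) k :=
    Finset.sum_le_sum_of_subset_of_nonneg (by simp) fun _ _ _ => M.pRun_nonneg _
  have h5 : M.pRun σ ([], q) 0 = 1 := by simp [pRun, run, expect_pure]
  rw [Finset.sum_range_succ'] at h4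
  have h6 : ∑ i ∈ Finset.Icc 1 n, M.pRun σ ([], q) i =
      ∑ k ∈ Finset.range n, M.pRun σ ([], q) (k + 1) := by
    rw [Finset.range_eq_Ico, Finset.sum_Ico_add' (fun k => M.pRun σ ([], q) k) 0 n 1]
    rfl
  simp only [← pRun_eq]
  linarith

section bounds

variable {C : ℝ} (hC1 : 1 ≤ C)
  (hC : ∀ n q, F.IsVertex q → M.stepsVal n (some ([], q)) ≤ C)

include hC1 hC

theorem sum_pRun_Ico_le (hF : F.WF) (hs : F.IsState s) (k n : ℕ) :
    ∑ j ∈ Finset.Ico k (k + n), M.pRun σ s j ≤ C * M.expHeight σ s k := by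
  have h := M.expect_gain_add_val_le (fun _ _ => 1) σ hs n k
  have hfin := M.finite_support_run σ hs k
  rw [expect_add hfin, M.expect_gain_eq_sum hs (fun _ => 1), M.expect_gain_eq_sum hs (fun _ => 1),
    ← Finset.sum_range_add_sum_Ico _ (Nat.le_add_right k n)] at h
  simp only [← pRun_eq] at h
  refine le_trans (by linarith) (?_ : expect (M.run σ s k) (fun x => M.stepsVal n x.2) ≤ _)
  rw [expHeight, ← expect_const_mul]
  refine expect_mono hfin ?_
  rintro ⟨h, _ | y⟩ hy
  · simp [height]
  · have := M.stepsVal_le hC1 hC hF n y.1 y.2 (M.isOutcome_of_mem_support_run σ hs k _ hy).state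
    simpa [height] using this

/-- The expected number of steps after time `K` is of order `1 / K`: it is at most `C` times the
expected height at any earlier time, and the expected heights have a bounded sum. -/
theorem mul_sum_pRun_le (hF : F.WF) (hs : F.IsState s) (K n : ℕ) :
    K * ∑ j ∈ Finset.Ico K (K + n), M.pRun σ s j ≤ 3 * C ^ 3 * (s.1.length + 1) ^ 2 := by
  have hC0 : 0 ≤ C := zero_le_one.trans hC1
  have h1 : ∀ k ∈ Finset.range K,
      ∑ j ∈ Finset.Ico K (K + n), M.pRun σ s j ≤ C * M.expHeight σ s k := by
    intro k hk
    have hk := Finset.mem_range.1 hk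
    refine le_trans ?_ (M.sum_pRun_Ico_le hC1 hC hF hs k (K + n - k))
    refine Finset.sum_le_sum_of_subset_of_nonneg ?_ fun _ _ _ => M.pRun_nonneg _
    exact Finset.Ico_subset_Ico hk.le (by omega)
  have h2 := Finset.sum_le_sum h1
  rw [Finset.sum_const, Finset.card_range, nsmul_eq_mul, ← Finset.mul_sum] at h2
  have h3 : ∑ k ∈ Finset.range K, M.expHeight σ s k ≤ 3 * C ^ 2 * (s.1.length + 1) ^ 2 := by
    simp only [M.expHeight_eq hs, Finset.sum_add_distrib]
    have h4 := (M.expect_gain_le_val (fun x _ => (x.1.length : ℝ)) σ hs K).trans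
      (M.stackVal_le hC1 hC hF K (κ := s.1) (q := s.2) hs)
    have h5 := (M.expect_gain_le_val (fun _ _ => 1) σ hs K).trans
      (M.stepsVal_le hC1 hC hF K s.1 s.2 hs)
    rw [M.expect_gain_eq_sum hs (fun x => (x.1.length : ℝ))] at h4
    rw [M.expect_gain_eq_sum hs (fun _ => 1)] at h5
    simp only [← pRun_eq] at h5
    have h6 : C * (s.1.length + 1) ≤ C ^ 2 * (s.1.length + 1) ^ 2 := by
      have hk : (0 : ℝ) ≤ s.1.length := Nat.cast_nonneg _
      have : 1 ≤ C * (s.1.length + 1) := by nlinarith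
      nlinarith
    linarith
  calc _ ≤ C * _ := h2
    _ ≤ C * (3 * C ^ 2 * (s.1.length + 1) ^ 2) := by gcongr
    _ = _ := by ring

end bounds

end RMDP

namespace RMDP

open Filter Topology

variable {F : Frame} (M : RMDP F) {σ : Strategy F} {s : State}

/-! ### Truncation of the total reward -/

theorem expReward_eq (k : ℕ) :
    M.expReward σ s k = expect (M.run σ s k) fun x => gain M.reward x.1 := rfl

theorem abs_reward_le {R : ℝ} (hR0 : 0 ≤ R) (hR : ∀ x ∈ F.queries, |M.r x.1 x.2| ≤ R)
    (hs : F.IsState s) {a : ℕ} (ha : a < F.numActions s.2) : |M.reward s a| ≤ R := by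
  unfold reward
  split_ifs with h
  · exact hR (s.2, a) ((F.mem_queries _ _).2 ⟨hs.1, h, ha⟩)
  · simpa using hR0

theorem abs_expReward_succ_sub_le {R : ℝ} (hR0 : 0 ≤ R) (hR : ∀ x ∈ F.queries, |M.r x.1 x.2| ≤ R)
    (hs : F.IsState s) (k : ℕ) :
    |M.expReward σ s (k + 1) - M.expReward σ s k| ≤ R * M.pRun σ s k := by
  have hfin := M.finite_support_run σ hs k
  have key : ∀ x ∈ (M.run σ s k).support,
      |expect (M.advance σ x) (fun z => gain M.reward z.1) - gain M.reward x.1| ≤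
        R * x.2.elim 0 fun _ => 1 := by
    rintro ⟨h, _ | y⟩ hy
    · simp [expect_advance_none]
    · have hy' := (M.isOutcome_of_mem_support_run σ hs k _ hy).state
      have hc := finite_support_choice σ h hy'
      rw [M.expect_advance_some σ h hy']
      simp only [gain_cons, Option.elim, mul_one]
      rw [expect_congr (g := fun a => M.reward y a + gain M.reward h) fun a ha =>
        expect_const (M.finite_support_step hy' (σ.avail h y hy' a ha)) _, expect_add hc,
        expect_const hc, add_sub_cancel_right]
      exact abs_expect_le hc fun a ha => M.abs_reward_le hR0 hR hy' (σ.avail h y hy' a ha)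
  rw [expReward_eq, expReward_eq, M.expect_run_succ σ hs, ← expect_sub hfin, pRun_eq,
    ← expect_const_mul, abs_le, ← neg_one_mul, ← expect_const_mul]
  refine ⟨expect_mono hfin fun x hx => ?_, expect_mono hfin fun x hx => ?_⟩
  · rw [neg_one_mul]
    exact (abs_le.1 (key x hx)).1
  · exact (abs_le.1 (key x hx)).2

theorem abs_expReward_add_sub_le {R : ℝ} (hR0 : 0 ≤ R) (hR : ∀ x ∈ F.queries, |M.r x.1 x.2| ≤ R)
    (hs : F.IsState s) (k n : ℕ) :
    |M.expReward σ s (k + n) - M.expReward σ s k| ≤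
      R * ∑ j ∈ Finset.Ico k (k + n), M.pRun σ s j := by
  induction n with
  | zero => simp
  | succ n ih =>
    rw [← add_assoc, Finset.sum_Ico_succ_top (Nat.le_add_right k n), mul_add]
    have h := M.abs_expReward_succ_sub_le (σ := σ) hR0 hR hs (k + n)
    calc _ = |(M.expReward σ s (k + n + 1) - M.expReward σ s (k + n)) +
          (M.expReward σ s (k + n) - M.expReward σ s k)| := by ring_nf
      _ ≤ _ := (abs_add_le _ _).trans (by linarith)

/-- The finitely many rewards have some bound; which one matters only later. -/
theorem exists_reward_bound : ∃ R : ℝ, 0 ≤ R ∧ ∀ x ∈ F.queries, |M.r x.1 x.2| ≤ R := by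
  refine ⟨∑ x ∈ F.queries.toFinset, |M.r x.1 x.2|, Finset.sum_nonneg fun _ _ => abs_nonneg _,
    fun x hx => ?_⟩
  exact Finset.single_le_sum (f := fun x : Vertex × ℕ => |M.r x.1 x.2|)
    (fun _ _ => abs_nonneg _) (List.mem_toFinset.2 hx)

section bounds

variable {C : ℝ} (hC1 : 1 ≤ C)
  (hC : ∀ n q, F.IsVertex q → M.stepsVal n (some ([], q)) ≤ C)

include hC1 hC

theorem tendsto_expReward (hF : F.WF) (hs : F.IsState s) :
    Tendsto (M.expReward σ s) atTop (𝓝 (M.totalReward σ s)) := by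
  obtain ⟨R, hR0, hR⟩ := M.exists_reward_bound
  have hsum : Summable (M.pRun σ s) := by
    refine summable_of_sum_range_le (c := C * M.expHeight σ s 0) (fun _ => M.pRun_nonneg _)
      fun n => ?_
    simpa using M.sum_pRun_Ico_le (σ := σ) hC1 hC hF hs 0 n
  have h1 : Summable fun k => M.expReward σ s (k + 1) - M.expReward σ s k :=
    (hsum.mul_left R).of_norm_bounded fun k => M.abs_expReward_succ_sub_le hR0 hR hs k
  have h2 := h1.hasSum.tendsto_sum_nat
  simp only [Finset.sum_range_sub] at h2
  have h3 := h2.add_const (M.expReward σ s 0)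
  simp only [sub_add_cancel] at h3
  rw [totalReward, h3.limUnder_eq]
  exact h3

theorem abs_totalReward_sub_le (hF : F.WF) {R : ℝ} (hR0 : 0 ≤ R)
    (hR : ∀ x ∈ F.queries, |M.r x.1 x.2| ≤ R) (hs : F.IsState s) {K : ℕ} (hK : 0 < K) :
    |M.totalReward σ s - M.expReward σ s K| ≤ R * (3 * C ^ 3 * (s.1.length + 1) ^ 2) / K := by
  have h1 := ((M.tendsto_expReward (σ := σ) hC1 hC hF hs).comp (tendsto_add_atTop_nat K)).sub_const
    (M.expReward σ s K)
  refine le_of_tendsto h1.abs (Eventually.of_forall fun n => ?_)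
  have hK' : (0 : ℝ) < K := Nat.cast_pos.2 hK
  have h2 := M.abs_expReward_add_sub_le (σ := σ) hR0 hR hs K n
  have h3 := M.mul_sum_pRun_le (σ := σ) hC1 hC hF hs K n
  rw [Function.comp_apply, add_comm n K]
  refine h2.trans ?_
  rw [le_div_iff₀ hK', mul_assoc, mul_comm _ (K : ℝ)]
  exact mul_le_mul_of_nonneg_left h3 hR0

/-- The optimal total reward is approximated by the optimal reward over a finite horizon. -/
theorem abs_optReward_sub_val_le (hF : F.WF) {R : ℝ} (hR0 : 0 ≤ R)
    (hR : ∀ x ∈ F.queries, |M.r x.1 x.2| ≤ R) (hs : F.IsState s) {K : ℕ} (hK : 0 < K) :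
    |M.optReward s - M.val M.reward K (some s)| ≤
      R * (3 * C ^ 3 * (s.1.length + 1) ^ 2) / K := by
  set E := R * (3 * C ^ 3 * (s.1.length + 1) ^ 2) / K
  have hup : ∀ σ : Strategy F, M.totalReward σ s ≤ M.val M.reward K (some s) + E := by
    intro σ
    have h1 := (abs_le.1 (M.abs_totalReward_sub_le (σ := σ) hC1 hC hF hR0 hR hs hK)).2
    have h2 := M.expect_gain_le_val M.reward σ hs K
    rw [← expReward_eq] at h2
    linarith
  obtain ⟨σ, hσ⟩ := M.exists_expect_gain_eq_val M.reward hF K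
  have h1 := (abs_le.1 (M.abs_totalReward_sub_le (σ := σ) hC1 hC hF hR0 hR hs hK)).1
  have h2 := hσ s hs
  rw [← expReward_eq] at h2
  have h3 : M.totalReward σ s ≤ M.optReward s :=
    le_ciSup (f := fun σ : Strategy F => M.totalReward σ s)
      ⟨_, Set.forall_mem_range.2 hup⟩ σ
  have : Nonempty (Strategy F) := ⟨σ⟩
  have h4 : M.optReward s ≤ M.val M.reward K (some s) + E := ciSup_le hup
  rw [abs_le]
  constructor <;> linarith

end bounds

/-! ### A bound for the rewards -/

/-- The expected reward over a finite horizon when action `0` is always chosen. -/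
def zeroVal : ℕ → Option State → ℝ
  | 0, _ => 0
  | _ + 1, none => 0
  | n + 1, some x => M.reward x 0 + expect (M.step x 0) (zeroVal n)

theorem expReward_of_eventually_zero (hs : F.IsState s) (n k : ℕ)
    (hσ : ∀ h x, k ≤ h.length → σ.choice h x = PMF.pure 0) :
    M.expReward σ s (k + n) =
      expect (M.run σ s k) fun x => gain M.reward x.1 + M.zeroVal n x.2 := by
  induction n generalizing k with
  | zero => simp [zeroVal, expReward_eq]
  | succ n ih =>
    rw [show k + (n + 1) = k + 1 + n by ring, ih (k + 1) fun h x hk => hσ h x (by omega),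
      M.expect_run_succ σ hs]
    refine expect_congr ?_
    rintro ⟨h, _ | y⟩ hy
    · cases n <;> simp [expect_advance_none, zeroVal]
    · have ho := M.isOutcome_of_mem_support_run σ hs k _ hy
      have hc := hσ h y (ho.length_eq (by simp)).ge
      have h0 : 0 < F.numActions y.2 := σ.avail h y ho.state 0 (by simp [hc])
      have hst := M.finite_support_step ho.state h0
      rw [M.expect_advance_some σ h ho.state, hc, expect_pure]
      simp only [gain_cons]
      rw [expect_add hst, expect_const hst, zeroVal]
      ring

/-- A bound for the total rewards of all strategies yields a bound for the rewards: the reward of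
an action is the difference of the total rewards of two strategies, one of which chooses this
action first and then does the same as the other. -/
theorem abs_r_le (hF : F.WF) {C : ℝ} (hC1 : 1 ≤ C)
    (hC : ∀ n q, F.IsVertex q → M.stepsVal n (some ([], q)) ≤ C) {ε b : ℝ} (hε : 0 ≤ ε)
    (hb : M.BoundedReward ε b) : ∀ x ∈ F.queries, |M.r x.1 x.2| ≤ 2 * b := by
  rintro ⟨q, a⟩ hx
  obtain ⟨hq, hsrc, ha⟩ := (F.mem_queries _ _).1 hx
  let σ₀ : Strategy F :=
    { choice := fun _ _ => PMF.pure 0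
      avail := by
        intro h x hx c hc
        rw [PMF.mem_support_pure_iff] at hc
        exact hc ▸ hF.numActions_pos hx.1 }
  let σ₁ : Strategy F :=
    { choice := fun h x => if h = [] ∧ a < F.numActions x.2 then PMF.pure a else PMF.pure 0
      avail := by
        intro h x hx c hc
        split_ifs at hc with hh
        · rw [PMF.mem_support_pure_iff] at hc
          exact hc ▸ hh.2
        · rw [PMF.mem_support_pure_iff] at hc
          exact hc ▸ hF.numActions_pos hx.1 }
  have hs : F.IsState ([], q) := Frame.isState_nil hq
  have hfin := M.finite_support_δ hq hsrc ha
  have h0 : ∀ v ∈ (M.δ q a).support, Tendsto (fun n => M.zeroVal n (some ([], v))) atTop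
      (𝓝 (M.totalReward σ₀ ([], v))) := by
    intro v hv
    have hv' := M.isState_of_mem_support_δ hs hsrc ha hv
    refine (M.tendsto_expReward (σ := σ₀) hC1 hC hF hv').congr fun n => ?_
    have := M.expReward_of_eventually_zero (σ := σ₀) hv' n 0 fun _ _ _ => rfl
    simpa [run, expect_pure] using this
  have h1 : ∀ n, M.expReward σ₁ ([], q) (n + 1) =
      M.r q a + expect (M.δ q a) fun v => M.zeroVal n (some ([], v)) := by
    intro n
    rw [add_comm n 1, M.expReward_of_eventually_zero hs n 1 (σ := σ₁) ?_]
    · rw [M.expect_run_succ σ₁ hs 0, run, expect_pure, M.expect_advance_some σ₁ _ hs]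
      have hc : σ₁.choice [] ([], q) = PMF.pure a := by simp [σ₁, ha]
      rw [hc, expect_pure, M.expect_step_source hq hsrc ha]
      simp only [gain_cons, gain_nil, add_zero]
      rw [expect_add hfin, expect_const hfin]
      simp [reward, hsrc]
    · intro h x hh
      have : h ≠ [] := by
        rintro rfl
        simp at hh
      simp [σ₁, this]
  have h2 : Tendsto (fun n => M.expReward σ₁ ([], q) (n + 1)) atTop
      (𝓝 (M.r q a + expect (M.δ q a) fun v => M.totalReward σ₀ ([], v))) := by
    simp only [h1, expect_eq_sum_toFinset hfin]
    refine tendsto_const_nhds.add (tendsto_finsetSum _ fun v hv => ?_)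
    exact (h0 v (hfin.mem_toFinset.1 hv)).const_mul _
  have h3 := tendsto_nhds_unique h2
    ((M.tendsto_expReward (σ := σ₁) hC1 hC hF hs).comp (tendsto_add_atTop_nat 1))
  have h4 := hb M (M.close_refl hε) σ₁ q hq
  have h5 : |expect (M.δ q a) fun v => M.totalReward σ₀ ([], v)| ≤ b :=
    abs_expect_le hfin fun v hv => hb M (M.close_refl hε) σ₀ v
      (M.isState_of_mem_support_δ hs hsrc ha hv).1
  rw [← h3] at h4
  rw [abs_le] at h4 h5 ⊢
  constructor <;> linarith

end RMDP

/-! ### Planning on the sampled model in integer arithmetic -/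

/-- The only successor of a call port or of an exit node with a pending call. -/
def follow (F : Frame) : State → Option State
  | (κ, .call i b j) => some ((i, b) :: κ, .entry (F.callee i b) j)
  | ((i, b) :: κ, .exit _ j) => some (κ, .ret i b j)
  | _ => none

/-- The sum of `w z v` over all observations of the action `a` at `q`, where `z` is the numerator of
the reading of the reward and `v` the successor. -/
def obsSum {R : Type*} [Zero R] [Add R] (D : List Obs) (q : Vertex) (a : ℕ)
    (w : ℤ → Vertex → R) : R :=
  (D.map fun o => if o.1 = q ∧ o.2.1 = a then w o.2.2.1 o.2.2.2 else 0).sum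

/-- Bellman's operator of the sampled model, multiplied by the number `N` of samples per action, so
that the averages over samples become sums. The weight `c` scales the readings of the rewards. -/
def backupZ (F : Frame) (D : List Obs) (N c : ℕ) (f : State → ℤ) (x : State) : ℤ :=
  if x.2.IsSource then
    ((List.range (F.numActions x.2)).map fun a =>
      obsSum D x.2 a fun z v => c * z + f (x.1, v)).foldl max
        (obsSum D x.2 0 fun z v => c * z + f (x.1, v))
  else (follow F x).elim 0 fun y => N * f y

/-- The optimal reward of the sampled model over a finite horizon `n`, multiplied by `N ^ n` and by
the common denominator of the readings of the rewards. -/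
def planZ (F : Frame) (D : List Obs) (N : ℕ) : ℕ → State → ℤ
  | 0, _ => 0
  | n + 1, x => backupZ F D N (N ^ n) (planZ F D N n) x

theorem le_foldl_max (l : List ℤ) (z : ℤ) :
    z ≤ l.foldl max z ∧ ∀ y ∈ l, y ≤ l.foldl max z := by
  induction l generalizing z with
  | nil => simp
  | cons x l ih =>
    obtain ⟨h1, h2⟩ := ih (max z x)
    refine ⟨(le_max_left _ _).trans h1, fun y hy => ?_⟩
    rcases List.mem_cons.1 hy with rfl | hy
    · exact (le_max_right _ _).trans h1
    · exact h2 y hy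

theorem foldl_max_mem (l : List ℤ) (z : ℤ) : l.foldl max z = z ∨ l.foldl max z ∈ l := by
  induction l generalizing z with
  | nil => simp
  | cons x l ih =>
    rw [List.foldl_cons, List.mem_cons]
    rcases ih (max z x) with h | h
    · rcases max_choice z x with h' | h' <;> rw [h, h'] <;> simp
    · exact Or.inr (Or.inr h)

section obsSum

variable {q : Vertex} {a : ℕ}

theorem obsSum_cast (D : List Obs) (w : ℤ → Vertex → ℤ) :
    ((obsSum D q a w : ℤ) : ℝ) = obsSum D q a fun z v => (w z v : ℝ) := by
  unfold obsSum
  induction D with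
  | nil => simp
  | cons o D ih =>
    simp only [List.map_cons, List.sum_cons, Int.cast_add, ih]
    congr 1
    split_ifs <;> simp

theorem obsSum_add (D : List Obs) (w w' : ℤ → Vertex → ℝ) :
    (obsSum D q a fun z v => w z v + w' z v) = obsSum D q a w + obsSum D q a w' := by
  unfold obsSum
  induction D with
  | nil => simp
  | cons o D ih =>
    simp only [List.map_cons, List.sum_cons, ih]
    split_ifs <;> ring

theorem obsSum_const_mul (D : List Obs) (c : ℝ) (w : ℤ → Vertex → ℝ) :
    (obsSum D q a fun z v => c * w z v) = c * obsSum D q a w := by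
  unfold obsSum
  induction D with
  | nil => simp
  | cons o D ih =>
    simp only [List.map_cons, List.sum_cons, ih]
    split_ifs <;> ring

theorem abs_obsSum_le {D : List Obs} {w w' : ℤ → Vertex → ℝ}
    (h : ∀ o ∈ D, o.1 = q → o.2.1 = a → |w o.2.2.1 o.2.2.2| ≤ w' o.2.2.1 o.2.2.2) :
    |obsSum D q a w| ≤ obsSum D q a w' := by
  unfold obsSum
  induction D with
  | nil => simp
  | cons o D ih =>
    simp only [List.map_cons, List.sum_cons]
    refine (abs_add_le _ _).trans (add_le_add ?_ (ih fun o ho => h o (List.mem_cons_of_mem _ ho)))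
    split_ifs with h1
    · exact h o List.mem_cons_self h1.1 h1.2
    · simp

theorem obsSum_congr {D : List Obs} {w w' : ℤ → Vertex → ℝ}
    (h : ∀ o ∈ D, o.1 = q → o.2.1 = a → w o.2.2.1 o.2.2.2 = w' o.2.2.1 o.2.2.2) :
    obsSum D q a w = obsSum D q a w' := by
  unfold obsSum
  congr 1
  refine List.map_congr_left fun o ho => ?_
  split_ifs with h1
  · exact h o ho h1.1 h1.2
  · rfl

/-- Grouping the observations by their successors. -/
theorem obsSum_eq_sum {D : List Obs} {T : Finset Vertex}
    (h : ∀ o ∈ D, o.1 = q → o.2.1 = a → o.2.2.2 ∈ T) (w : Vertex → ℝ) :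
    (obsSum D q a fun _ v => w v) =
      ∑ v ∈ T, (obsSum D q a fun _ v' => if v' = v then 1 else 0) * w v := by
  unfold obsSum
  induction D with
  | nil => simp
  | cons o D ih =>
    simp only [List.map_cons, List.sum_cons, add_mul, Finset.sum_add_distrib]
    rw [ih fun o ho => h o (List.mem_cons_of_mem _ ho)]
    congr 1
    split_ifs with h1
    · simp [h o List.mem_cons_self h1.1 h1.2]
    · simp

end obsSum

namespace RMDP

variable {F : Frame} (M : RMDP F)

theorem abs_val_le {g : State → ℕ → ℝ} {R : ℝ} (hF : F.WF)
    (hg : ∀ x a, F.IsState x → a < F.numActions x.2 → |g x a| ≤ R) (n : ℕ) :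
    ∀ t, F.IsOptState t → |M.val g n t| ≤ n * max R 0 := by
  induction n with
  | zero => intro t _; simp
  | succ n ih =>
    rintro (_ | x) hx
    · simp only [val_none, abs_zero]
      positivity
    · obtain ⟨a, ha, h⟩ := M.exists_val_succ_eq g hF n hx
      rw [h]
      have h1 := abs_expect_le (M.finite_support_step hx ha) fun t ht =>
        ih t (M.isOptState_of_mem_support_step hx ha ht)
      have h2 := hg x a hx ha
      have h3 := le_max_left R 0
      push_cast
      refine (abs_add_le _ _).trans ?_
      linarith

/-- Observations that have the intended form and in which every source-action pair has been
observed `N` times, with frequencies of the successors within `θ` of their probabilities. -/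
structure IsTypical (ρ : Vertex → ℕ → ℤ) (N : ℕ) (θ : ℝ) (D : List Obs) : Prop where
  reading : ∀ o ∈ D, o.2.2.1 = ρ o.1 o.2.1
  succ : ∀ o ∈ D, o.2.2.2 ∈ (M.δ o.1 o.2.1).support
  count : ∀ x ∈ F.queries, (obsSum D x.1 x.2 fun _ _ => (1 : ℝ)) = N
  freq : ∀ x ∈ F.queries, ∀ v ∈ F.targets,
    |(obsSum D x.1 x.2 fun _ v' => if v' = v then (1 : ℝ) else 0) - N * (M.δ x.1 x.2 v).toReal| ≤
      θ * N

variable {M} {ρ : Vertex → ℕ → ℤ} {N : ℕ} {θ : ℝ} {D : List Obs}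

/-- One source-action pair of the sampled model: the readings of the reward are off by at most `η`,
the values used at the successors by at most `e`, and the frequencies of the successors by at
most `θ`. -/
theorem IsTypical.abs_obsSum_sub_le (hD : M.IsTypical ρ N θ D) (hθ : 0 ≤ θ) {q : Vertex} {a : ℕ}
    (hx : (q, a) ∈ F.queries) {m η e B : ℝ} (hρ : |(ρ q a : ℝ) / m - M.r q a| ≤ η)
    {w V : Vertex → ℝ} (hw : ∀ v ∈ (M.δ q a).support, |w v - V v| ≤ e)
    (hV : ∀ v ∈ (M.δ q a).support, |V v| ≤ B) (hB : 0 ≤ B) :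
    |(obsSum D q a fun z v => (z : ℝ) / m + w v) - N * (M.r q a + expect (M.δ q a) V)| ≤
      N * (η + e + F.targets.length * θ * B) := by
  obtain ⟨hq, hs, ha⟩ := (F.mem_queries q a).1 hx
  have hsub : (M.δ q a).support ⊆ F.targets.toFinset := by
    intro v hv
    obtain ⟨h1, h2, -⟩ := M.mem_target q a hq hs ha v hv
    simpa using Frame.mem_targets h1 h2
  have hsucc : ∀ o ∈ D, o.1 = q → o.2.1 = a → o.2.2.2 ∈ (M.δ q a).support := by
    rintro o ho rfl rfl
    exact hD.succ o ho
  have hcnt := hD.count _ hx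
  have hconst : ∀ c : ℝ, (obsSum D q a fun _ _ => c) = N * c := by
    intro c
    have := obsSum_const_mul (q := q) (a := a) D c fun _ _ => 1
    simpa [hcnt, mul_comm] using this
  have h1 : (obsSum D q a fun z _ => (z : ℝ) / m) = N * (ρ q a / m) := by
    rw [← hconst]
    refine obsSum_congr fun o ho h1 h2 => ?_
    rw [hD.reading o ho, h1, h2]
  have h2 : |obsSum D q a fun _ v => w v - V v| ≤ N * e := by
    rw [← hconst]
    exact abs_obsSum_le fun o ho h1 h2 => hw _ (hsucc o ho h1 h2)
  have h3 : (obsSum D q a fun _ v => w v) =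
      (obsSum D q a fun _ v => w v - V v) + obsSum D q a fun _ v => V v := by
    rw [← obsSum_add]
    exact obsSum_congr fun o _ _ _ => by ring
  classical
  -- Outside the support of `δ` no bound for `V` is known, but no such successor is observed either.
  let V' : Vertex → ℝ := fun v => if v ∈ (M.δ q a).support then V v else 0
  have hV' : ∀ v, |V' v| ≤ B := by
    intro v
    by_cases hv : v ∈ (M.δ q a).support
    · simpa only [V', if_pos hv] using hV v hv
    · simpa only [V', if_neg hv, abs_zero] using hB
  have h4 : |(obsSum D q a fun _ v => V v) - N * expect (M.δ q a) V| ≤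
      F.targets.length * (θ * N * B) := by
    have e1 : (obsSum D q a fun _ v => V v) = obsSum D q a fun _ v => V' v :=
      obsSum_congr fun o ho h1 h2 => (if_pos (hsucc o ho h1 h2)).symm
    have e2 : expect (M.δ q a) V = expect (M.δ q a) V' :=
      expect_congr fun v hv => (if_pos hv).symm
    rw [e1, e2, expect_eq_sum hsub, obsSum_eq_sum (T := F.targets.toFinset)
      (fun o ho h1 h2 => hsub (hsucc o ho h1 h2)), Finset.mul_sum, ← Finset.sum_sub_distrib]
    refine (Finset.abs_sum_le_sum_abs _ _).trans ?_
    refine (Finset.sum_le_sum (g := fun _ => θ * N * B) fun v hv => ?_).trans ?_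
    · rw [← mul_assoc, ← sub_mul, abs_mul]
      have := hD.freq _ hx v (List.mem_toFinset.1 hv)
      exact mul_le_mul this (hV' v) (abs_nonneg _) (by positivity)
    · rw [Finset.sum_const, nsmul_eq_mul]
      have : (F.targets.toFinset.card : ℝ) ≤ F.targets.length := by
        exact_mod_cast List.toFinset_card_le _
      gcongr
  have h5 : |(N : ℝ) * (ρ q a / m) - N * M.r q a| ≤ N * η := by
    rw [← mul_sub, abs_mul, Nat.abs_cast]
    gcongr
  rw [obsSum_add, h1, h3]
  rw [abs_le] at *
  constructor <;> linarith [h2.1, h2.2, h4.1, h4.2, h5.1, h5.2]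

/-- On typical observations the optimal rewards over a finite horizon of the sampled and of the true
model are close. -/
theorem IsTypical.abs_planZ_sub_val_le (hF : F.WF) (hD : M.IsTypical ρ N θ D) (hθ : 0 ≤ θ)
    (hN : 0 < N) {m : ℕ} (hm : 0 < m) {η B : ℝ} (hη : 0 ≤ η)
    (hρ : ∀ x ∈ F.queries, |(ρ x.1 x.2 : ℝ) / m - M.r x.1 x.2| ≤ η) (hB : 0 ≤ B) {K : ℕ}
    (hV : ∀ n ≤ K, ∀ t, F.IsOptState t → |M.val M.reward n t| ≤ B) (n : ℕ) (hn : n ≤ K) :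
    ∀ x, F.IsState x → |(planZ F D N n x : ℝ) / (N ^ n * m) - M.val M.reward n (some x)| ≤
      n * (η + F.targets.length * θ * B) := by
  set E : ℝ := η + F.targets.length * θ * B with hE
  have hE0 : 0 ≤ E := by positivity
  have hN' : (0 : ℝ) < N := Nat.cast_pos.2 hN
  have hm' : (0 : ℝ) < m := Nat.cast_pos.2 hm
  induction n with
  | zero => intro x _; simp [planZ]
  | succ n ih =>
    specialize ih (by omega)
    rintro ⟨κ, q⟩ hx
    have hpos : (0 : ℝ) < N ^ n * m := by positivity
    by_cases hq : q.IsSource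
    · have hact : ∀ a < F.numActions q,
          |((obsSum D q a fun z v => ((N ^ n : ℕ) : ℤ) * z + planZ F D N n (κ, v) : ℤ) : ℝ) /
            (N ^ (n + 1) * m) -
            (M.reward (κ, q) a + expect (M.step (κ, q) a) (M.val M.reward n))| ≤
          (n + 1 : ℕ) * E := by
        intro a ha
        have hxa := (F.mem_queries q a).2 ⟨hx.1, hq, ha⟩
        have h1 := hD.abs_obsSum_sub_le hθ hxa (hρ _ hxa)
          (w := fun v => (planZ F D N n (κ, v) : ℝ) / (N ^ n * m))
          (V := fun v => M.val M.reward n (some (κ, v)))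
          (fun v hv => ih (κ, v) (M.isState_of_mem_support_δ hx hq ha hv))
          (fun v hv => hV n (by omega) (some (κ, v)) (M.isState_of_mem_support_δ hx hq ha hv)) hB
        have h2 : ((obsSum D q a fun z v => ((N ^ n : ℕ) : ℤ) * z + planZ F D N n (κ, v) : ℤ) : ℝ) =
            (N ^ n * m) * obsSum D q a fun z v =>
              (z : ℝ) / m + (planZ F D N n (κ, v) : ℝ) / (N ^ n * m) := by
          rw [obsSum_cast, ← obsSum_const_mul]
          refine obsSum_congr fun o _ _ _ => ?_
          push_cast
          field_simp
        rw [h2, M.expect_step_source hx.1 hq ha, reward, if_pos hq]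
        rw [show (N : ℝ) ^ (n + 1) * m = (N ^ n * m) * N by ring, mul_div_mul_left _ _ hpos.ne']
        rw [abs_le] at h1 ⊢
        push_cast
        rw [le_sub_iff_add_le, le_div_iff₀ hN', sub_le_iff_le_add, div_le_iff₀ hN']
        constructor <;> nlinarith [h1.1, h1.2]
      simp only [planZ, backupZ, if_pos hq]
      have hpos' : (0 : ℝ) < N ^ (n + 1) * m := by positivity
      set f : ℕ → ℤ := fun a =>
        obsSum D q a fun z v => ((N ^ n : ℕ) : ℤ) * z + planZ F D N n (κ, v) with hf
      have hle := le_foldl_max ((List.range (F.numActions q)).map f) (f 0)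
      have hmem : ∃ a < F.numActions q,
          ((List.range (F.numActions q)).map f).foldl max (f 0) = f a := by
        rcases foldl_max_mem ((List.range (F.numActions q)).map f) (f 0) with h | h
        · exact ⟨0, hF.numActions_pos hx.1, h⟩
        · obtain ⟨a, ha, h⟩ := List.mem_map.1 h
          exact ⟨a, List.mem_range.1 ha, h.symm⟩
      rw [abs_le]
      constructor
      · obtain ⟨a, ha, h⟩ := M.exists_val_succ_eq M.reward hF n hx
        have h1 := (abs_le.1 (hact a ha)).1
        have h2 : (f a : ℝ) / (N ^ (n + 1) * m) ≤
            ((((List.range (F.numActions q)).map f).foldl max (f 0) : ℤ) : ℝ) /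
              (N ^ (n + 1) * m) := by
          gcongr
          exact hle.2 _ (List.mem_map.2 ⟨a, List.mem_range.2 ha, rfl⟩)
        rw [h]
        linarith
      · obtain ⟨a, ha, h⟩ := hmem
        rw [h]
        have h1 := (abs_le.1 (hact a ha)).2
        have h2 := M.le_val_succ M.reward n (κ, q) ha
        linarith
    · have hstep : ∀ y, F.IsState y → follow F (κ, q) = some y →
          (∀ a, M.step (κ, q) a = PMF.pure (some y)) →
          |(planZ F D N (n + 1) (κ, q) : ℝ) / (N ^ (n + 1) * m) -
            M.val M.reward (n + 1) (some (κ, q))| ≤ (n + 1 : ℕ) * E := by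
        intro y hy h1 h2
        rw [M.val_succ_of_step_eq_pure hF M.reward n hx (c := 0) (fun a => if_neg hq) h2]
        have h3 := ih y hy
        have h4 : (planZ F D N (n + 1) (κ, q) : ℝ) / (N ^ (n + 1) * m) =
            (planZ F D N n y : ℝ) / (N ^ n * m) := by
          simp only [planZ, backupZ, if_neg hq, h1, Option.elim]
          push_cast
          field_simp
          ring
        rw [h4, zero_add]
        push_cast
        linarith
      rcases not_isSource_iff.1 hq with ⟨i, b, j, rfl⟩ | ⟨i, j, rfl⟩
      · exact hstep _ hx.call (by cases κ <;> rfl) (M.step_call _ _ _ _)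
      · cases κ with
        | nil =>
          rw [M.val_succ_of_step_eq_pure hF M.reward n hx (c := 0) (fun a => if_neg hq)
            (fun _ => rfl), val_none]
          simp only [planZ, backupZ, if_neg hq, follow, Option.elim]
          simp only [Int.cast_zero, zero_div, add_zero, sub_zero, abs_zero]
          positivity
        | cons p κ => exact hstep _ hx.exit rfl fun _ => rfl

end RMDP

/-! ### Deviations of the samples -/

theorem toOuterMeasure_eq_ofReal_expect {α : Type*} {p : PMF α} (hp : p.support.Finite)
    (A : Set α) : p.toOuterMeasure A = ENNReal.ofReal (expect p (A.indicator 1)) := by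
  rw [PMF.toOuterMeasure_apply, expect_eq_sum_toFinset hp, ENNReal.ofReal_sum_of_nonneg]
  · rw [tsum_eq_sum (s := hp.toFinset)]
    · refine Finset.sum_congr rfl fun x _ => ?_
      by_cases hx : x ∈ A
      · simp [hx, ENNReal.ofReal_toReal (p.apply_ne_top x)]
      · simp [hx]
    · intro x hx
      have : p x = 0 := by
        by_contra h
        exact hx (hp.mem_toFinset.2 ((PMF.mem_support_iff _ _).2 h))
      simp [Set.indicator, this]
  · intro x _
    exact mul_nonneg ENNReal.toReal_nonneg (Set.indicator_nonneg (by simp) _)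

/-- Markov's inequality. -/
theorem le_toOuterMeasure_of_expect_le {α : Type*} {p : PMF α} (hp : p.support.Finite)
    {A : Set α} {f : α → ℝ} {t β : ℝ} (ht : 0 < t) (hf : ∀ x, 0 ≤ f x)
    (hA : ∀ x ∈ p.support, f x ≤ t → x ∈ A) (h : expect p f ≤ β * t) :
    ENNReal.ofReal (1 - β) ≤ p.toOuterMeasure A := by
  rw [toOuterMeasure_eq_ofReal_expect hp]
  refine ENNReal.ofReal_le_ofReal ?_
  have h1 : expect p (fun x => 1 - t⁻¹ * f x) ≤ expect p (A.indicator 1) := by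
    refine expect_mono hp fun x hx => ?_
    by_cases hxA : x ∈ A
    · have := mul_nonneg (inv_nonneg.2 ht.le) (hf x)
      simp only [Set.indicator_of_mem hxA, Pi.one_apply]
      linarith
    · have h2 : t ≤ f x := (lt_of_not_ge fun h => hxA (hA x hx h)).le
      have h3 : 1 ≤ t⁻¹ * f x := by
        rw [inv_mul_eq_div, le_div_iff₀ ht]
        linarith
      simp only [Set.indicator_of_notMem hxA]
      linarith
  rw [expect_sub hp, expect_const hp, expect_const_mul] at h1
  have h2 : t⁻¹ * expect p f ≤ β := by
    rw [inv_mul_eq_div, div_le_iff₀ ht]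
    exact h
  linarith

namespace Frame

theorem nodup_sources (F : Frame) (i : ℕ) : (F.sources i).Nodup := by
  have h1 : ∀ (n : ℕ) (f : ℕ → Vertex), Function.Injective f → ((List.range n).map f).Nodup :=
    fun n f hf => List.nodup_range.map hf
  unfold sources
  refine List.Nodup.append (List.Nodup.append (h1 _ _ ?_) (h1 _ _ ?_) ?_) ?_ ?_
  · intro x y h; simpa using h
  · intro x y h; simpa using h
  · simp [List.disjoint_left]
  · rw [List.nodup_flatMap]
    refine ⟨fun b _ => h1 _ _ (fun x y h => by simpa using h), ?_⟩
    refine List.Pairwise.imp (R := (· ≠ ·)) ?_ List.nodup_range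
    intro b b' hb
    simp [Function.onFun, List.disjoint_left, hb.symm]
  · simp only [List.disjoint_left, List.mem_append, List.mem_map, List.mem_flatMap]
    rintro _ (⟨j, -, rfl⟩ | ⟨j, -, rfl⟩) <;> simp

theorem comp_of_mem_sources {F : Frame} {i : ℕ} {v : Vertex} (h : v ∈ F.sources i) :
    v.comp = i := by
  simp only [sources, List.mem_append, List.mem_map, List.mem_flatMap] at h
  rcases h with (⟨j, -, rfl⟩ | ⟨j, -, rfl⟩) | ⟨b, -, j, -, rfl⟩ <;> rfl

theorem nodup_queries (F : Frame) : F.queries.Nodup := by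
  unfold queries
  rw [List.nodup_flatMap]
  constructor
  · intro i _
    rw [List.nodup_flatMap]
    refine ⟨fun v _ => List.nodup_range.map fun x y h => by simpa using h, ?_⟩
    refine List.Pairwise.imp (R := (· ≠ ·)) ?_ (F.nodup_sources i)
    intro v v' hv
    simp [Function.onFun, List.disjoint_left, hv.symm]
  · refine List.Pairwise.imp (R := (· ≠ ·)) ?_ List.nodup_range
    intro i i' hi
    rw [Function.onFun, List.disjoint_left]
    intro x hx hx'
    simp only [List.mem_flatMap, List.mem_map] at hx hx'
    obtain ⟨v, hv, a, -, rfl⟩ := hx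
    obtain ⟨v', hv', a', -, h⟩ := hx'
    simp only [Prod.mk.injEq] at h
    exact hi (by rw [← comp_of_mem_sources hv, ← comp_of_mem_sources hv', h.1])

end Frame

theorem le_sum_map {α : Type*} {l : List α} {f : α → ℝ} (hf : ∀ x ∈ l, 0 ≤ f x) {x : α}
    (hx : x ∈ l) : f x ≤ (l.map f).sum := by
  refine List.single_le_sum ?_ _ (List.mem_map.2 ⟨x, hx, rfl⟩)
  intro y hy
  obtain ⟨z, hz, rfl⟩ := List.mem_map.1 hy
  exact hf z hz

theorem count_flatMap_replicate {α : Type*} [DecidableEq α] [BEq α] [LawfulBEq α] {l : List α} (hl : l.Nodup) (N : ℕ)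
    (x : α) : (l.flatMap (List.replicate N)).count x = if x ∈ l then N else 0 := by
  induction l with
  | nil => simp
  | cons y l ih =>
    rw [List.nodup_cons] at hl
    rw [List.flatMap_cons, List.count_append, ih hl.2, List.count_replicate]
    by_cases h : y = x
    · subst h
      simp [hl.1]
    · have h' : x ≠ y := fun e => h e.symm
      simp [h, h']

namespace RMDP

variable {F : Frame} (M : RMDP F) (ρ : Vertex → ℕ → ℤ)

theorem finite_support_δ_of_mem {x : Vertex × ℕ} (hx : x ∈ F.queries) :
    (M.δ x.1 x.2).support.Finite := by
  obtain ⟨h1, h2, h3⟩ := (F.mem_queries x.1 x.2).1 hx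
  exact M.finite_support_δ h1 h2 h3

theorem finite_support_observe {l : List (Vertex × ℕ)} (hl : ∀ x ∈ l, x ∈ F.queries) :
    (M.observe ρ l).support.Finite := by
  induction l with
  | nil => exact finite_support_pure _
  | cons x l ih =>
    exact finite_support_bind (M.finite_support_δ_of_mem (hl x List.mem_cons_self)) fun v _ =>
      finite_support_map (ih fun y hy => hl y (List.mem_cons_of_mem _ hy)) _

theorem expect_observe_cons {x : Vertex × ℕ} {l : List (Vertex × ℕ)}
    (hl : ∀ y ∈ x :: l, y ∈ F.queries) (f : List Obs → ℝ) :
    expect (M.observe ρ (x :: l)) f = expect (M.δ x.1 x.2) fun v =>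
      expect (M.observe ρ l) fun D => f ((x.1, x.2, ρ x.1 x.2, v) :: D) := by
  have h1 := M.finite_support_observe ρ fun y hy => hl y (List.mem_cons_of_mem _ hy)
  refine (expect_bind (M.finite_support_δ_of_mem (hl x List.mem_cons_self)) (fun v _ =>
      finite_support_map h1 _) f).trans ?_
  exact expect_congr fun v _ => expect_map h1 _ _

theorem observe_spec {l : List (Vertex × ℕ)} {D : List Obs} (hD : D ∈ (M.observe ρ l).support) :
    (∀ o ∈ D, o.2.2.1 = ρ o.1 o.2.1 ∧ o.2.2.2 ∈ (M.δ o.1 o.2.1).support) ∧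
      ∀ x : Vertex × ℕ, (obsSum D x.1 x.2 fun _ _ => (1 : ℝ)) = l.count x := by
  induction l generalizing D with
  | nil =>
    rw [observe, PMF.mem_support_pure_iff] at hD
    subst hD
    simp [obsSum]
  | cons y l ih =>
    rw [observe, PMF.mem_support_bind_iff] at hD
    obtain ⟨v, hv, hD⟩ := hD
    rw [PMF.support_map] at hD
    obtain ⟨D', hD', rfl⟩ := hD
    obtain ⟨h1, h2⟩ := ih hD'
    refine ⟨fun o ho => ?_, fun x => ?_⟩
    · rcases List.mem_cons.1 ho with rfl | ho
      · exact ⟨rfl, hv⟩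
      · exact h1 o ho
    · have h3 := h2 x
      unfold obsSum at h3 ⊢
      rw [List.map_cons, List.sum_cons, h3, List.count_cons]
      by_cases h : y = x
      · subst h
        simp [add_comm]
      · have h' : ¬ (y.1 = x.1 ∧ y.2 = x.2) := fun e => h (Prod.ext e.1 e.2)
        simp [h, h']

/-- The deviation of the number of observed successors `v` of a source-action pair from its
expectation. -/
def deviation (x : Vertex × ℕ) (v : Vertex) (D : List Obs) : ℝ :=
  obsSum D x.1 x.2 fun _ v' => (if v' = v then 1 else 0) - (M.δ x.1 x.2 v).toReal

/-- The variance of a sum of independent centred indicators is at most their number. -/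
theorem expect_deviation_sq_le (x : Vertex × ℕ) (v : Vertex) {l : List (Vertex × ℕ)}
    (hl : ∀ y ∈ l, y ∈ F.queries) :
    expect (M.observe ρ l) (fun D => M.deviation x v D ^ 2) ≤ l.count x := by
  induction l with
  | nil => simp [observe, expect_pure, deviation, obsSum]
  | cons y l ih =>
    have hl' : ∀ y ∈ l, y ∈ F.queries := fun y hy => hl y (List.mem_cons_of_mem _ hy)
    have hfin := M.finite_support_observe ρ hl'
    have hfy := M.finite_support_δ_of_mem (hl y List.mem_cons_self)
    specialize ih hl'
    rw [M.expect_observe_cons ρ hl]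
    by_cases h : y = x
    · subst h
      set p := (M.δ y.1 y.2 v).toReal with hp
      have hp0 : 0 ≤ p := ENNReal.toReal_nonneg
      have hp1 : p ≤ 1 := by
        rw [hp, ← ENNReal.toReal_one]
        exact ENNReal.toReal_mono ENNReal.one_ne_top (PMF.coe_le_one _ _)
      have hdev : ∀ v' D, M.deviation y v ((y.1, y.2, ρ y.1 y.2, v') :: D) =
          ((if v' = v then 1 else 0) - p) + M.deviation y v D := by
        intro v' D
        simp [deviation, obsSum, hp]
      set m1 := expect (M.observe ρ l) fun D => M.deviation y v D with hm1
      set m2 := expect (M.observe ρ l) fun D => M.deviation y v D ^ 2 with hm2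
      have h1 : ∀ v', expect (M.observe ρ l)
          (fun D => M.deviation y v ((y.1, y.2, ρ y.1 y.2, v') :: D) ^ 2) =
          ((if v' = v then 1 else 0) - p) ^ 2 + m2 + 2 * m1 * ((if v' = v then 1 else 0) - p) := by
        intro v'
        have e : ∀ D, M.deviation y v ((y.1, y.2, ρ y.1 y.2, v') :: D) ^ 2 =
            (((if v' = v then 1 else 0) - p) ^ 2 + M.deviation y v D ^ 2) +
              2 * ((if v' = v then 1 else 0) - p) * M.deviation y v D := by
          intro D
          rw [hdev]
          ring
        simp only [e]
        rw [expect_add hfin, expect_add hfin, expect_const hfin, expect_const_mul]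
        ring
      simp only [h1]
      have hmean : expect (M.δ y.1 y.2) (fun v' => (if v' = v then 1 else 0) - p) = 0 := by
        rw [expect_sub hfy, expect_const hfy, expect, tsum_eq_single v]
        · simp [hp]
        · intro v' hv'
          simp [hv']
      rw [expect_add hfy, expect_const_mul, hmean, expect_add hfy, expect_const hfy]
      have h2 : expect (M.δ y.1 y.2) (fun v' => ((if v' = v then 1 else 0) - p) ^ 2) ≤ 1 := by
        refine (expect_mono hfy (g := fun _ => 1) fun v' _ => ?_).trans (expect_const hfy 1).le
        split_ifs <;> nlinarith
      rw [List.count_cons_self]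
      push_cast
      linarith
    · have hdev : ∀ v' D, M.deviation x v ((y.1, y.2, ρ y.1 y.2, v') :: D) =
          M.deviation x v D := by
        intro v' D
        have h' : ¬ (y.1 = x.1 ∧ y.2 = x.2) := fun e => h (Prod.ext e.1 e.2)
        simp [deviation, obsSum, h']
      simp only [hdev]
      rw [expect_const hfy, List.count_cons_of_ne h]
      exact ih

/-- With high probability the observations are typical. -/
theorem le_toOuterMeasure_isTypical {N : ℕ} {θ β : ℝ} (hθ : 0 < θ) (hN : 0 < N)
    (h : (F.queries.length * F.targets.length : ℝ) ≤ β * (θ ^ 2 * N)) :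
    ENNReal.ofReal (1 - β) ≤ (M.data ρ N).toOuterMeasure {D | M.IsTypical ρ N θ D} := by
  have hN' : (0 : ℝ) < N := Nat.cast_pos.2 hN
  have hl : ∀ y ∈ F.queries.flatMap (List.replicate N), y ∈ F.queries := by
    intro y hy
    obtain ⟨z, hz, hy⟩ := List.mem_flatMap.1 hy
    exact List.eq_of_mem_replicate hy ▸ hz
  have hcount : ∀ x ∈ F.queries, (F.queries.flatMap (List.replicate N)).count x = N := by
    intro x hx
    exact (count_flatMap_replicate F.nodup_queries N x).trans (if_pos hx)
  have hfin := M.finite_support_observe ρ hl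
  have hnn : ∀ (D : List Obs) (x : Vertex × ℕ),
      0 ≤ (F.targets.map fun v => M.deviation x v D ^ 2).sum := fun D x =>
    List.sum_nonneg (by simp only [List.mem_map]; rintro _ ⟨v, -, rfl⟩; positivity)
  refine le_toOuterMeasure_of_expect_le hfin (t := (θ * N) ^ 2)
    (f := fun D => (F.queries.map fun x => (F.targets.map fun v =>
      M.deviation x v D ^ 2).sum).sum) (by positivity) (fun D => ?_) ?_ ?_
  · refine List.sum_nonneg ?_
    simp only [List.mem_map]
    rintro _ ⟨x, -, rfl⟩
    exact hnn D x
  · intro D hD hle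
    obtain ⟨h1, h2⟩ := M.observe_spec ρ hD
    refine ⟨fun o ho => (h1 o ho).1, fun o ho => (h1 o ho).2, fun x hx => ?_, fun x hx v hv => ?_⟩
    · rw [h2 x, hcount x hx]
    · have h3 : M.deviation x v D ^ 2 ≤ (θ * N) ^ 2 :=
        ((le_sum_map (f := fun v => M.deviation x v D ^ 2) (fun _ _ => sq_nonneg _) hv).trans
          (le_sum_map (fun x _ => hnn D x) hx)).trans hle
      have h4 := abs_le_of_sq_le_sq' h3 (by positivity)
      have h5 : M.deviation x v D = (obsSum D x.1 x.2 fun _ v' => if v' = v then (1 : ℝ) else 0) -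
          N * (M.δ x.1 x.2 v).toReal := by
        have e := obsSum_add (q := x.1) (a := x.2) D
          (fun _ v' => if v' = v then (1 : ℝ) else 0) (fun _ _ => -(M.δ x.1 x.2 v).toReal * 1)
        rw [obsSum_const_mul, h2 x, hcount x hx] at e
        rw [deviation, ← sub_eq_zero]
        simp only [mul_one, ← sub_eq_add_neg] at e
        rw [e]
        ring
      rw [← h5]
      exact abs_le.2 h4
  · rw [expect_list_sum hfin]
    have h1 : ∀ x ∈ F.queries, expect (M.observe ρ (F.queries.flatMap (List.replicate N)))
        (fun D => (F.targets.map fun v => M.deviation x v D ^ 2).sum) ≤ F.targets.length * N := by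
      intro x hx
      rw [expect_list_sum hfin]
      refine (List.sum_le_card_nsmul _ (N : ℝ) ?_).trans (by simp)
      simp only [List.mem_map]
      rintro _ ⟨v, -, rfl⟩
      have := M.expect_deviation_sq_le ρ x v hl
      rwa [hcount x hx] at this
    refine (List.sum_le_card_nsmul _ (F.targets.length * N : ℝ) ?_).trans ?_
    · simp only [List.mem_map]
      rintro _ ⟨x, hx, rfl⟩
      exact h1 x hx
    · rw [List.length_map, nsmul_eq_mul]
      calc _ = (F.queries.length * F.targets.length : ℝ) * N := by ring
        _ ≤ β * (θ ^ 2 * N) * N := by gcongr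
        _ = _ := by ring

end RMDP

/-! ### Primitive recursive integer arithmetic -/

section Int

open Primrec

theorem primrec_intEquivNatSumNat : Primrec Equiv.intEquivNatSumNat :=
  Primrec.encode_iff.1 <| (Primrec.encode (α := ℤ)).of_eq fun z => by cases z <;> rfl

theorem primrec_int_ofNat : Primrec Int.ofNat :=
  Primrec.encode_iff.1 <| (Primrec.encode.comp (Primrec.sumInl (α := ℕ) (β := ℕ))).of_eq
    fun _ => rfl

theorem primrec_int_negSucc : Primrec Int.negSucc :=
  Primrec.encode_iff.1 <| (Primrec.encode.comp (Primrec.sumInr (α := ℕ) (β := ℕ))).of_eq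
    fun _ => rfl

theorem primrec_toNat : Primrec Int.toNat :=
  (Primrec.sumCasesOn primrec_intEquivNatSumNat Primrec₂.right (Primrec.const 0).to₂).of_eq
    fun z => by cases z <;> rfl

theorem primrec_toNat_neg : Primrec fun z : ℤ => (-z).toNat :=
  (Primrec.sumCasesOn primrec_intEquivNatSumNat (Primrec.const 0).to₂
    (Primrec.succ.comp₂ Primrec₂.right)).of_eq fun z => by
      cases z with
      | ofNat n => exact (Int.toNat_eq_zero.2 (by simp)).symm
      | negSucc n => rfl

theorem primrec_natCast_sub : Primrec₂ fun m n : ℕ => (m : ℤ) - n :=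
  (Primrec.ite (Primrec.nat_le.comp Primrec.snd Primrec.fst)
    (primrec_int_ofNat.comp (Primrec.nat_sub.comp Primrec.fst Primrec.snd))
    (primrec_int_negSucc.comp
      (Primrec.pred.comp (Primrec.nat_sub.comp Primrec.snd Primrec.fst)))).to₂.of_eq
    fun m n => by
      simp only
      split_ifs with h
      · simp only [Int.ofNat_eq_natCast]
        omega
      · simp only [Nat.pred_eq_sub_one]
        omega

theorem primrec_int_add : Primrec₂ fun x y : ℤ => x + y :=
  (primrec_natCast_sub.comp
    (Primrec.nat_add.comp (primrec_toNat.comp Primrec.fst) (primrec_toNat.comp Primrec.snd))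
    (Primrec.nat_add.comp (primrec_toNat_neg.comp Primrec.fst)
      (primrec_toNat_neg.comp Primrec.snd))).to₂.of_eq fun x y => by
    simp only
    omega

theorem primrec_natCast_mul : Primrec₂ fun (n : ℕ) (z : ℤ) => (n : ℤ) * z :=
  (primrec_natCast_sub.comp
    (Primrec.nat_mul.comp Primrec.fst (primrec_toNat.comp Primrec.snd))
    (Primrec.nat_mul.comp Primrec.fst (primrec_toNat_neg.comp Primrec.snd))).to₂.of_eq
    fun n z => by
      simp only
      push_cast
      rw [← mul_sub]
      congr 1
      omega

theorem primrec_int_max : Primrec₂ fun x y : ℤ => max x y :=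
  (Primrec.ite (Primrec.nat_le.comp
      (Primrec.nat_add.comp (primrec_toNat.comp Primrec.fst) (primrec_toNat_neg.comp Primrec.snd))
      (Primrec.nat_add.comp (primrec_toNat.comp Primrec.snd) (primrec_toNat_neg.comp Primrec.fst)))
    Primrec.snd Primrec.fst).to₂.of_eq fun x y => by
    simp only
    split_ifs <;> omega

end Int

/-! ### Computability of the frame and of the plan -/

section Frame

variable {α σ : Type*} [Primcodable α] [Primcodable σ]

theorem primrec_vertex_casesOn {f : α → Vertex} {ge gi gx : α → ℕ × ℕ → σ}
    {gc gr : α → ℕ × ℕ × ℕ → σ} (hf : Primrec f) (hge : Primrec₂ ge) (hgi : Primrec₂ gi)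
    (hgx : Primrec₂ gx) (hgc : Primrec₂ gc) (hgr : Primrec₂ gr) :
    Primrec fun a => (Vertex.casesOn (f a) (fun i j => ge a (i, j)) (fun i j => gi a (i, j))
      (fun i j => gx a (i, j)) (fun i b j => gc a (i, b, j)) (fun i b j => gr a (i, b, j)) : σ) := by
  have he : Primrec vertexEquiv := Primrec.of_equiv
  refine (Primrec.sumCasesOn (he.comp hf) hge (Primrec.sumCasesOn Primrec.snd
    (hgi.comp₂ (Primrec.fst.comp₂ Primrec₂.left) Primrec₂.right)
    (Primrec.sumCasesOn Primrec.snd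
      (hgx.comp₂ ((Primrec.fst.comp Primrec.fst).comp₂ Primrec₂.left) Primrec₂.right)
      (Primrec.sumCasesOn Primrec.snd
        (hgc.comp₂ ((Primrec.fst.comp (Primrec.fst.comp Primrec.fst)).comp₂ Primrec₂.left)
          Primrec₂.right)
        (hgr.comp₂ ((Primrec.fst.comp (Primrec.fst.comp Primrec.fst)).comp₂ Primrec₂.left)
          Primrec₂.right)).to₂).to₂).to₂).of_eq fun a => ?_
  cases f a <;> rfl

theorem primrec_entry : Primrec₂ Vertex.entry :=
  (((Primrec.of_equiv_symm : Primrec vertexEquiv.symm)).comp Primrec.sumInl).of_eq fun _ => rfl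

theorem primrec_inner : Primrec₂ Vertex.inner :=
  (((Primrec.of_equiv_symm : Primrec vertexEquiv.symm)).comp
    (Primrec.sumInr.comp Primrec.sumInl)).of_eq fun _ => rfl

theorem primrec_exit : Primrec₂ Vertex.exit :=
  (((Primrec.of_equiv_symm : Primrec vertexEquiv.symm)).comp
    (Primrec.sumInr.comp (Primrec.sumInr.comp Primrec.sumInl))).of_eq fun _ => rfl

theorem primrec_call : Primrec fun x : ℕ × ℕ × ℕ => Vertex.call x.1 x.2.1 x.2.2 :=
  (((Primrec.of_equiv_symm : Primrec vertexEquiv.symm)).comp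
    (Primrec.sumInr.comp (Primrec.sumInr.comp (Primrec.sumInr.comp Primrec.sumInl)))).of_eq
    fun _ => rfl

theorem primrec_ret : Primrec fun x : ℕ × ℕ × ℕ => Vertex.ret x.1 x.2.1 x.2.2 :=
  (((Primrec.of_equiv_symm : Primrec vertexEquiv.symm)).comp
    (Primrec.sumInr.comp (Primrec.sumInr.comp (Primrec.sumInr.comp Primrec.sumInr)))).of_eq
    fun _ => rfl

theorem primrec_componentEquiv : Primrec componentEquiv := Primrec.of_equiv

theorem primrec_actions : Primrec Component.actions :=
  (Primrec.fst.comp primrec_componentEquiv).of_eq fun _ => rfl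

theorem primrec_entries : Primrec Component.entries :=
  (Primrec.fst.comp (Primrec.snd.comp primrec_componentEquiv)).of_eq fun _ => rfl

theorem primrec_exits : Primrec Component.exits :=
  (Primrec.fst.comp (Primrec.snd.comp (Primrec.snd.comp primrec_componentEquiv))).of_eq
    fun _ => rfl

theorem primrec_inners : Primrec Component.inners :=
  (Primrec.fst.comp (Primrec.snd.comp (Primrec.snd.comp
    (Primrec.snd.comp primrec_componentEquiv)))).of_eq fun _ => rfl

theorem primrec_boxes : Primrec Component.boxes :=
  (Primrec.snd.comp (Primrec.snd.comp (Primrec.snd.comp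
    (Primrec.snd.comp primrec_componentEquiv)))).of_eq fun _ => rfl

theorem primrec_frame_comp : Primrec₂ Frame.comp := Primrec.list_getD default

theorem primrec_callee {F : α → Frame} {i b : α → ℕ} (hF : Primrec F) (hi : Primrec i)
    (hb : Primrec b) : Primrec fun a => (F a).callee (i a) (b a) :=
  (Primrec.list_getD 0).comp (primrec_boxes.comp (primrec_frame_comp.comp hF hi)) hb

theorem primrec_vertex_comp : Primrec Vertex.comp :=
  (primrec_vertex_casesOn Primrec.id (Primrec.fst.comp₂ Primrec₂.right)
    (Primrec.fst.comp₂ Primrec₂.right) (Primrec.fst.comp₂ Primrec₂.right)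
    (Primrec.fst.comp₂ Primrec₂.right) (Primrec.fst.comp₂ Primrec₂.right)).of_eq
    fun v => by cases v <;> rfl

theorem primrec_numActions : Primrec₂ Frame.numActions :=
  primrec_actions.comp (primrec_frame_comp.comp Primrec.fst
    (primrec_vertex_comp.comp Primrec.snd))

theorem primrecPred_isSource : PrimrecPred Vertex.IsSource :=
  Primrec.primrecPred <|
    (primrec_vertex_casesOn Primrec.id (Primrec.const true).to₂ (Primrec.const true).to₂
      (Primrec.const false).to₂ (Primrec.const false).to₂ (Primrec.const true).to₂).of_eq
      fun v => by cases v <;> rfl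

theorem primrec_sources : Primrec₂ Frame.sources := by
  have hF : Primrec fun x : Frame × ℕ => x.1 := Primrec.fst
  have hC := primrec_frame_comp.comp hF Primrec.snd
  refine Primrec.list_append.comp (Primrec.list_append.comp ?_ ?_) ?_
  · exact Primrec.list_map (Primrec.list_range.comp (primrec_entries.comp hC))
      (primrec_entry.comp₂ (Primrec.snd.comp₂ Primrec₂.left) Primrec₂.right)
  · exact Primrec.list_map (Primrec.list_range.comp (primrec_inners.comp hC))
      (primrec_inner.comp₂ (Primrec.snd.comp₂ Primrec₂.left) Primrec₂.right)
  · refine Primrec.list_flatMap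
      (Primrec.list_range.comp (Primrec.list_length.comp (primrec_boxes.comp hC))) ?_
    refine Primrec.list_map (Primrec.list_range.comp (primrec_exits.comp (primrec_frame_comp.comp
      (hF.comp Primrec.fst)
      (primrec_callee (hF.comp Primrec.fst) (Primrec.snd.comp Primrec.fst) Primrec.snd)))) ?_
    exact primrec_ret.comp₂ ((Primrec.pair (Primrec.snd.comp (Primrec.fst.comp Primrec.fst))
      (Primrec.pair (Primrec.snd.comp Primrec.fst) Primrec.snd)).to₂)

theorem primrec_queries : Primrec Frame.queries := by
  refine Primrec.list_flatMap (Primrec.list_range.comp Primrec.list_length) ?_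
  refine Primrec.list_flatMap primrec_sources ?_
  refine Primrec.list_map (Primrec.list_range.comp (primrec_actions.comp
    (primrec_frame_comp.comp (Primrec.fst.comp Primrec.fst) (Primrec.snd.comp Primrec.fst)))) ?_
  exact (Primrec.pair (Primrec.snd.comp Primrec.fst) Primrec.snd).to₂

theorem primrec_targets : Primrec Frame.targets := by
  have hF : Primrec fun x : Frame × ℕ => x.1 := Primrec.fst
  have hC := primrec_frame_comp.comp hF Primrec.snd
  refine Primrec.list_flatMap (Primrec.list_range.comp Primrec.list_length) ?_
  refine Primrec.list_append.comp (Primrec.list_append.comp ?_ ?_) ?_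
  · exact Primrec.list_map (Primrec.list_range.comp (primrec_inners.comp hC))
      (primrec_inner.comp₂ (Primrec.snd.comp₂ Primrec₂.left) Primrec₂.right)
  · exact Primrec.list_map (Primrec.list_range.comp (primrec_exits.comp hC))
      (primrec_exit.comp₂ (Primrec.snd.comp₂ Primrec₂.left) Primrec₂.right)
  · refine Primrec.list_flatMap
      (Primrec.list_range.comp (Primrec.list_length.comp (primrec_boxes.comp hC))) ?_
    refine Primrec.list_map (Primrec.list_range.comp (primrec_entries.comp (primrec_frame_comp.comp
      (hF.comp Primrec.fst)
      (primrec_callee (hF.comp Primrec.fst) (Primrec.snd.comp Primrec.fst) Primrec.snd)))) ?_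
    exact primrec_call.comp₂ ((Primrec.pair (Primrec.snd.comp (Primrec.fst.comp Primrec.fst))
      (Primrec.pair (Primrec.snd.comp Primrec.fst) Primrec.snd)).to₂)

theorem primrec_follow : Primrec₂ follow := by
  have hc : Primrec₂ fun (x : Frame × State) (y : ℕ × ℕ × ℕ) =>
      some (((y.1, y.2.1) :: x.2.1, Vertex.entry (x.1.callee y.1 y.2.1) y.2.2) : State) := by
    have h1 : Primrec fun z : (Frame × State) × ℕ × ℕ × ℕ => z.2.1 :=
      Primrec.fst.comp Primrec.snd
    have h2 : Primrec fun z : (Frame × State) × ℕ × ℕ × ℕ => z.2.2.1 :=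
      Primrec.fst.comp (Primrec.snd.comp Primrec.snd)
    have h3 : Primrec fun z : (Frame × State) × ℕ × ℕ × ℕ => z.2.2.2 :=
      Primrec.snd.comp (Primrec.snd.comp Primrec.snd)
    exact (Primrec.option_some.comp (Primrec.pair
      (Primrec.list_cons.comp (Primrec.pair h1 h2)
        (Primrec.fst.comp (Primrec.snd.comp Primrec.fst)))
      (primrec_entry.comp (primrec_callee (Primrec.fst.comp Primrec.fst) h1 h2) h3))).to₂
  have he : Primrec₂ fun (x : Frame × State) (y : ℕ × ℕ) =>
      (List.casesOn x.2.1 none fun p κ => some (κ, Vertex.ret p.1 p.2 y.2) : Option State) := by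
    refine Primrec.to₂ (Primrec.list_casesOn (Primrec.fst.comp (Primrec.snd.comp Primrec.fst))
      (Primrec.const none) (h := fun (z : (Frame × State) × ℕ × ℕ)
        (w : (ℕ × ℕ) × List (ℕ × ℕ)) => some (w.2, Vertex.ret w.1.1 w.1.2 z.2.2)) ?_)
    have h1 : Primrec fun u : ((Frame × State) × ℕ × ℕ) × (ℕ × ℕ) × List (ℕ × ℕ) => u.2.1 :=
      Primrec.fst.comp Primrec.snd
    exact (Primrec.option_some.comp (Primrec.pair (Primrec.snd.comp Primrec.snd)
      (primrec_ret.comp (Primrec.pair (Primrec.fst.comp h1) (Primrec.pair (Primrec.snd.comp h1)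
        (Primrec.snd.comp (Primrec.snd.comp Primrec.fst))))))).to₂
  refine (primrec_vertex_casesOn (Primrec.snd.comp Primrec.snd) (Primrec.const none).to₂
    (Primrec.const none).to₂ he hc (Primrec.const none).to₂).to₂.of_eq ?_
  rintro F ⟨_ | ⟨p, κ⟩, v⟩ <;> cases v <;> rfl

theorem primrec_obsSum {D : α → List Obs} {q : α → Vertex} {c : α → ℕ} {w : α → ℤ → Vertex → ℤ}
    (hD : Primrec D) (hq : Primrec q) (hc : Primrec c)
    (hw : Primrec fun z : α × ℤ × Vertex => w z.1 z.2.1 z.2.2) :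
    Primrec fun a => obsSum (D a) (q a) (c a) (w a) := by
  have ho : Primrec fun z : α × Obs => z.2 := Primrec.snd
  have h1 : Primrec₂ fun (a : α) (o : Obs) =>
      if o.1 = q a ∧ o.2.1 = c a then w a o.2.2.1 o.2.2.2 else 0 := by
    exact (Primrec.ite (PrimrecPred.and
      (Primrec.eq.comp (Primrec.fst.comp ho) (hq.comp Primrec.fst))
      (Primrec.eq.comp (Primrec.fst.comp (Primrec.snd.comp ho)) (hc.comp Primrec.fst)))
      (hw.comp (Primrec.pair Primrec.fst (Primrec.snd.comp (Primrec.snd.comp ho))))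
      (Primrec.const 0)).to₂
  refine (Primrec.list_foldr (Primrec.list_map hD h1) (Primrec.const 0)
    (h := fun _ p => p.1 + p.2) (primrec_int_add.comp (Primrec.fst.comp Primrec.snd)
      (Primrec.snd.comp Primrec.snd)).to₂).of_eq fun a => rfl

theorem primrec_backupZ {F : α → Frame} {D : α → List Obs} {N c : α → ℕ} {f : α → State → ℤ}
    {x : α → State} (hF : Primrec F) (hD : Primrec D) (hN : Primrec N) (hc : Primrec c)
    (hf : Primrec₂ f) (hx : Primrec x) :
    Primrec fun a => backupZ (F a) (D a) (N a) (c a) (f a) (x a) := by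
  have hq := Primrec.snd.comp hx
  have hsum : Primrec₂ fun (a : α) (k : ℕ) =>
      obsSum (D a) (x a).2 k fun z v => c a * z + f a ((x a).1, v) := by
    refine Primrec.to₂ (primrec_obsSum
      (w := fun (u : α × ℕ) z v => c u.1 * z + f u.1 ((x u.1).1, v))
      (hD.comp Primrec.fst) (hq.comp Primrec.fst) Primrec.snd ?_)
    have ha : Primrec fun z : (α × ℕ) × ℤ × Vertex => z.1.1 := Primrec.fst.comp Primrec.fst
    exact primrec_int_add.comp
      (primrec_natCast_mul.comp (hc.comp ha) (Primrec.fst.comp Primrec.snd))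
      (hf.comp ha (Primrec.pair (Primrec.fst.comp (hx.comp ha)) (Primrec.snd.comp Primrec.snd)))
  refine Primrec.ite (primrecPred_isSource.comp hq) ?_ ?_
  · exact Primrec.list_foldl (Primrec.list_map (Primrec.list_range.comp
      (primrec_numActions.comp hF hq)) hsum) (hsum.comp Primrec.id (Primrec.const 0))
      (h := fun _ p => max p.1 p.2)
      (primrec_int_max.comp (Primrec.fst.comp Primrec.snd) (Primrec.snd.comp Primrec.snd)).to₂
  · refine (Primrec.option_casesOn (primrec_follow.comp hF hx) (Primrec.const 0)
      (g := fun a y => N a * f a y)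
      (primrec_natCast_mul.comp (hN.comp Primrec.fst) hf).to₂).of_eq fun a => ?_
    cases follow (F a) (x a) <;> rfl

/-- The states at which Bellman's operator of the sampled model reads the value function. -/
def succs (F : Frame) (D : List Obs) (x : State) : List State :=
  (follow F x).toList ++ D.map fun o => (x.1, o.2.2.2)

theorem backupZ_congr {F : Frame} {D : List Obs} {N c : ℕ} {f f' : State → ℤ} {x : State}
    (h : ∀ y ∈ succs F D x, f y = f' y) : backupZ F D N c f x = backupZ F D N c f' x := by
  have h1 : ∀ k, (obsSum D x.2 k fun z v => c * z + f (x.1, v)) =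
      obsSum D x.2 k fun z v => c * z + f' (x.1, v) := by
    intro k
    unfold obsSum
    congr 1
    refine List.map_congr_left fun o ho => ?_
    simp only
    rw [h _ (List.mem_append_right _ (List.mem_map.2 ⟨o, ho, rfl⟩))]
  unfold backupZ
  simp only [h1]
  congr 1
  cases hy : follow F x with
  | none => rfl
  | some y =>
    simp only [Option.elim]
    rw [h y (List.mem_append_left _ (by simp [hy]))]

/-- The value of `f` at `y`, read off from the list of the values of `f` at the elements of `l`.
The default `0` is returned only if `y` is not in `l`. -/
def readOff (l : List State) (vals : List ℤ) (y : State) : ℤ :=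
  vals.getD (l.findIdx fun z => decide (z = y)) 0

theorem readOff_map {l : List State} (f : State → ℤ) {y : State} (hy : y ∈ l) :
    readOff l (l.map f) y = f y := by
  unfold readOff
  have h : l.findIdx (fun z => decide (z = y)) < l.length :=
    List.findIdx_lt_length_of_exists ⟨y, hy, by simp⟩
  rw [List.getD_eq_getElem _ _ (by simpa using h), List.getElem_map]
  congr 1
  simpa using List.findIdx_getElem (w := h)

theorem primrec_readOff {l : α → List State} {vals : α → List ℤ} {y : α → State}
    (hl : Primrec l) (hv : Primrec vals) (hy : Primrec y) :
    Primrec fun a => readOff (l a) (vals a) (y a) := by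
  have h : Primrec₂ fun (a : α) (z : State) => decide (z = y a) :=
    (PrimrecPred.decide (Primrec.eq.comp Primrec.snd (hy.comp Primrec.fst))).to₂
  exact (Primrec.list_getD 0).comp hv (Primrec.list_findIdx hl h)

theorem primrec₂_planZ :
    Primrec₂ fun (p : Frame × List Obs × ℕ) (b : ℕ × State) => planZ p.1 p.2.1 p.2.2 b.1 b.2 := by
  have hsucc : Primrec fun z : (Frame × List Obs × ℕ) × ℕ × State =>
      succs z.1.1 z.1.2.1 z.2.2 := by
    refine Primrec.list_append.comp (Primrec.optionToList.comp (primrec_follow.comp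
      (Primrec.fst.comp Primrec.fst) (Primrec.snd.comp Primrec.snd))) ?_
    refine Primrec.list_map (Primrec.fst.comp (Primrec.snd.comp Primrec.fst)) ?_
    exact (Primrec.pair (Primrec.fst.comp (Primrec.snd.comp (Primrec.snd.comp Primrec.fst)))
      (Primrec.snd.comp (Primrec.snd.comp (Primrec.snd.comp Primrec.snd)))).to₂
  refine Primrec.nat_omega_rec _ (m := fun _ b => b.1)
    (l := fun p b => Nat.casesOn b.1 [] fun n => (succs p.1 p.2.1 b.2).map fun y => (n, y))
    (g := fun p z => some (Nat.casesOn z.1.1 0 fun n => backupZ p.1 p.2.1 p.2.2 (p.2.2 ^ n)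
      (readOff (succs p.1 p.2.1 z.1.2) z.2) z.1.2))
    (Primrec.fst.comp₂ Primrec₂.right) ?_ ?_ ?_ ?_
  · refine Primrec.to₂ (Primrec.nat_casesOn (Primrec.fst.comp Primrec.snd) (Primrec.const [])
      (h := fun (z : (Frame × List Obs × ℕ) × ℕ × State) n =>
        (succs z.1.1 z.1.2.1 z.2.2).map fun y => (n, y)) ?_)
    exact Primrec.to₂ (Primrec.list_map (hsucc.comp Primrec.fst)
      (Primrec.pair (Primrec.snd.comp Primrec.fst) Primrec.snd).to₂)
  · refine Primrec.to₂ (Primrec.option_some.comp (Primrec.nat_casesOn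
      (Primrec.fst.comp (Primrec.fst.comp Primrec.snd)) (Primrec.const 0)
      (h := fun (u : (Frame × List Obs × ℕ) × (ℕ × State) × List ℤ) n =>
        backupZ u.1.1 u.1.2.1 u.1.2.2 (u.1.2.2 ^ n)
          (readOff (succs u.1.1 u.1.2.1 u.2.1.2) u.2.2) u.2.1.2) ?_))
    have hp : Primrec fun u : ((Frame × List Obs × ℕ) × (ℕ × State) × List ℤ) × ℕ => u.1.1 :=
      Primrec.fst.comp Primrec.fst
    have hx : Primrec fun u : ((Frame × List Obs × ℕ) × (ℕ × State) × List ℤ) × ℕ => u.1.2.1 :=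
      Primrec.fst.comp (Primrec.snd.comp Primrec.fst)
    have hN := Primrec.snd.comp (Primrec.snd.comp hp)
    have hpow : Primrec₂ fun m n : ℕ => m ^ n :=
      Primrec₂.unpaired'.1 Nat.Primrec.pow
    refine Primrec.to₂ (primrec_backupZ
      (f := fun (w : ((Frame × List Obs × ℕ) × (ℕ × State) × List ℤ) × ℕ) =>
        readOff (succs w.1.1.1 w.1.1.2.1 w.1.2.1.2) w.1.2.2) (Primrec.fst.comp hp)
      (Primrec.fst.comp (Primrec.snd.comp hp)) hN (hpow.comp hN Primrec.snd) ?_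
      (Primrec.snd.comp hx))
    exact (primrec_readOff (hsucc.comp (Primrec.pair (hp.comp Primrec.fst)
      (hx.comp Primrec.fst))) (Primrec.snd.comp (Primrec.snd.comp (Primrec.fst.comp Primrec.fst)))
      Primrec.snd).to₂
  · rintro p ⟨_ | n, x⟩ ⟨k, y⟩ hy
    · simp at hy
    · simp only [List.mem_map, Prod.mk.injEq] at hy
      obtain ⟨_, -, rfl, -⟩ := hy
      exact Nat.lt_succ_self _
  · rintro p ⟨_ | n, x⟩
    · rfl
    · simp only [List.map_map, planZ]
      congr 1
      exact backupZ_congr fun y hy => readOff_map (planZ p.1 p.2.1 p.2.2 n) hy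

theorem primrec_planZ {F : α → Frame} {D : α → List Obs} {N n : α → ℕ} {x : α → State}
    (hF : Primrec F) (hD : Primrec D) (hN : Primrec N) (hn : Primrec n) (hx : Primrec x) :
    Primrec fun a => planZ (F a) (D a) (N a) (n a) (x a) :=
  primrec₂_planZ.comp (Primrec.pair hF (Primrec.pair hD hN)) (Primrec.pair hn hx)

end Frame

/-! ### The learner -/

/-- A horizon after which the total reward still to come is at most half of the accuracy. -/
def horizon (I : Input) : ℕ :=
  12 * I.1.b * (1 + I.1.c₀ * I.1.invMu) ^ 3 * (I.2.2.1.length + 1) ^ 2 * I.1.invAcc + 1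

/-- The inverse of the accuracy to which transition probabilities are estimated. -/
def resolution (I : Input) : ℕ :=
  8 * horizon I ^ 2 * I.1.b * I.2.1.targets.length * I.1.invAcc + 1

/-- How often every source-action pair is sampled. -/
def sampleCount (I : Input) : ℕ :=
  I.2.1.queries.length * I.2.1.targets.length * resolution I ^ 2 * I.1.invConf + 1

/-- Certainty-equivalent planning: solve the finite-horizon problem for the sampled model. -/
def planner : Learner where
  samples := sampleCount
  precision I := 4 * horizon I * I.1.invAcc
  output I D := (planZ I.2.1 D (sampleCount I) (horizon I) I.2.2,
    sampleCount I ^ horizon I * (4 * horizon I * I.1.invAcc + 1) - 1)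

section Computability

variable {α : Type*} [Primcodable α]

theorem primrec_pow {f g : α → ℕ} (hf : Primrec f) (hg : Primrec g) :
    Primrec fun a => f a ^ g a :=
  (Primrec₂.unpaired'.1 Nat.Primrec.pow : Primrec₂ fun m n : ℕ => m ^ n).comp hf hg

theorem primrec_mul {f g : α → ℕ} (hf : Primrec f) (hg : Primrec g) :
    Primrec fun a => f a * g a :=
  Primrec.nat_mul.comp hf hg

theorem primrec_add {f g : α → ℕ} (hf : Primrec f) (hg : Primrec g) :
    Primrec fun a => f a + g a :=
  Primrec.nat_add.comp hf hg

theorem primrec_paramsEquiv : Primrec paramsEquiv := Primrec.of_equiv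

theorem primrec_params_c₀ : Primrec Params.c₀ :=
  (Primrec.fst.comp primrec_paramsEquiv).of_eq fun _ => rfl

theorem primrec_params_invMu : Primrec Params.invMu :=
  (Primrec.fst.comp (Primrec.snd.comp primrec_paramsEquiv)).of_eq fun _ => rfl

theorem primrec_params_b : Primrec Params.b :=
  (Primrec.fst.comp (Primrec.snd.comp (Primrec.snd.comp primrec_paramsEquiv))).of_eq fun _ => rfl

theorem primrec_params_invAcc : Primrec Params.invAcc :=
  (Primrec.fst.comp (Primrec.snd.comp (Primrec.snd.comp
    (Primrec.snd.comp primrec_paramsEquiv)))).of_eq fun _ => rfl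

theorem primrec_params_invConf : Primrec Params.invConf :=
  (Primrec.snd.comp (Primrec.snd.comp (Primrec.snd.comp
    (Primrec.snd.comp primrec_paramsEquiv)))).of_eq fun _ => rfl

theorem primrec_frame : Primrec fun I : Input => I.2.1 := Primrec.fst.comp Primrec.snd

theorem primrec_horizon : Primrec horizon := by
  have h1 : Primrec fun I : Input => I.1 := Primrec.fst
  refine primrec_add (primrec_mul (primrec_mul (primrec_mul (primrec_mul (Primrec.const 12)
    (primrec_params_b.comp h1)) (primrec_pow (primrec_add (Primrec.const 1)
    (primrec_mul (primrec_params_c₀.comp h1) (primrec_params_invMu.comp h1))) (Primrec.const 3)))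
    (primrec_pow (primrec_add (Primrec.list_length.comp ?_) (Primrec.const 1)) (Primrec.const 2)))
    (primrec_params_invAcc.comp h1)) (Primrec.const 1)
  exact Primrec.fst.comp (Primrec.snd.comp Primrec.snd)

theorem primrec_resolution : Primrec resolution :=
  primrec_add (primrec_mul (primrec_mul (primrec_mul (primrec_mul (Primrec.const 8)
    (primrec_pow primrec_horizon (Primrec.const 2))) (primrec_params_b.comp Primrec.fst))
    (Primrec.list_length.comp (primrec_targets.comp primrec_frame)))
    (primrec_params_invAcc.comp Primrec.fst)) (Primrec.const 1)

theorem primrec_sampleCount : Primrec sampleCount :=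
  primrec_add (primrec_mul (primrec_mul (primrec_mul
    (Primrec.list_length.comp (primrec_queries.comp primrec_frame))
    (Primrec.list_length.comp (primrec_targets.comp primrec_frame)))
    (primrec_pow primrec_resolution (Primrec.const 2)))
    (primrec_params_invConf.comp Primrec.fst)) (Primrec.const 1)

theorem primrec_precision : Primrec planner.precision :=
  primrec_mul (primrec_mul (Primrec.const 4) primrec_horizon)
    (primrec_params_invAcc.comp Primrec.fst)

theorem primrec_output : Primrec₂ planner.output := by
  have hI : Primrec fun z : Input × List Obs => z.1 := Primrec.fst
  have hK : Primrec fun z : Input × List Obs => horizon z.1 := primrec_horizon.comp hI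
  have hN : Primrec fun z : Input × List Obs => sampleCount z.1 := primrec_sampleCount.comp hI
  have hν : Primrec fun z : Input × List Obs => 4 * horizon z.1 * z.1.1.invAcc :=
    primrec_precision.comp hI
  have h1 : Primrec fun z : Input × List Obs =>
      planZ z.1.2.1 z.2 (sampleCount z.1) (horizon z.1) z.1.2.2 :=
    primrec_planZ (primrec_frame.comp hI) Primrec.snd hN hK
      (Primrec.snd.comp (Primrec.snd.comp hI))
  have h2 : Primrec fun z : Input × List Obs =>
      sampleCount z.1 ^ horizon z.1 * (4 * horizon z.1 * z.1.1.invAcc + 1) - 1 :=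
    Primrec.nat_sub.comp (primrec_mul (primrec_pow hN hK)
      (primrec_add hν (Primrec.const 1))) (Primrec.const 1)
  exact Primrec.pair h1 h2

theorem isComputable_planner : planner.IsComputable :=
  ⟨primrec_sampleCount.to_comp, primrec_precision.to_comp, primrec_output.to_comp⟩

end Computability

namespace RMDP

variable {F : Frame} (M : RMDP F)

/-- On typical observations the estimate of the learner is accurate: half of the admissible error
is used for the truncation at the horizon, a quarter for the readings of the rewards and a quarter
for the estimates of the transition probabilities. -/
theorem IsTypical.abs_estimate_sub_optReward_le {M : RMDP F} (hF : F.WF) {ε c₀ μ b : ℝ}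
    (hε : 0 < ε) (hμ : 0 < μ) (hM : M.FallingHeight ε c₀ μ)
    (hb : M.BoundedReward ε b) {s : State} (hs : F.IsState s) {α β : ℝ} (hα : 0 < α)
    {P : Params} (hP : P.Bounds c₀ μ b α β) {ρ : Vertex → ℕ → ℤ}
    (hρ : M.IsReading (planner.precision (P, F, s)) ρ) {D : List Obs}
    (hD : M.IsTypical ρ (planner.samples (P, F, s)) (1 / resolution (P, F, s)) D) :
    |planner.estimate (P, F, s) D - M.optReward s| ≤ α := by
  obtain ⟨hPc, hPμ, hPb, hPα, -⟩ := hP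
  set I : Input := (P, F, s) with hI
  set K := horizon I with hK
  have hK0 : 0 < K := Nat.succ_pos _
  have hK' : (0 : ℝ) < K := Nat.cast_pos.2 hK0
  have hA0 : (0 : ℝ) < P.invAcc := (by positivity : 0 < 1 / α).trans_le hPα
  have hα' : 1 / (P.invAcc : ℝ) ≤ α := by
    rw [div_le_iff₀ hA0]
    rwa [div_le_iff₀ hα, mul_comm] at hPα
  set C : ℝ := 1 + P.c₀ * P.invMu with hCdef
  have hC1 : 1 ≤ C := by
    have : (0 : ℝ) ≤ P.c₀ * P.invMu := by positivity
    linarith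
  have hC : ∀ n q, F.IsVertex q → M.stepsVal n (some ([], q)) ≤ C := by
    intro n q hq
    refine (M.stepsVal_le_of_fallingHeight hF hε.le hμ hM n hq).trans ?_
    have h1 : c₀ / μ ≤ P.c₀ * P.invMu := by
      rw [div_eq_mul_one_div]
      gcongr
    linarith
  set R : ℝ := 2 * P.b with hRdef
  have hR0 : 0 ≤ R := by positivity
  have hR : ∀ x ∈ F.queries, |M.r x.1 x.2| ≤ R := fun x hx =>
    (M.abs_r_le hF hC1 hC hε.le hb x hx).trans (by linarith)
  have htrunc := M.abs_optReward_sub_val_le hC1 hC hF hR0 hR hs hK0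
  have h1 : R * (3 * C ^ 3 * (s.1.length + 1) ^ 2) / K ≤ 1 / (2 * P.invAcc) := by
    rw [div_le_div_iff₀ hK' (by positivity)]
    have : (K : ℝ) = 12 * P.b * C ^ 3 * (s.1.length + 1) ^ 2 * P.invAcc + 1 := by
      rw [hK, horizon, hCdef, hI]
      push_cast
      ring
    rw [this, hRdef]
    linarith
  have hV : ∀ n ≤ K, ∀ t, F.IsOptState t → |M.val M.reward n t| ≤ K * R := by
    intro n hn t ht
    refine (M.abs_val_le hF (fun x a hx ha => M.abs_reward_le hR0 hR hx ha) n t ht).trans ?_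
    rw [max_eq_left hR0]
    gcongr
  have hΘ0 : (0 : ℝ) < resolution I := Nat.cast_pos.2 (Nat.succ_pos _)
  have hN0 : 0 < planner.samples I := Nat.succ_pos _
  set ν := planner.precision I with hν
  have hν0 : (0 : ℝ) < ν + 1 := by positivity
  have hplan := hD.abs_planZ_sub_val_le hF (by positivity) hN0 (m := ν + 1) (Nat.succ_pos _)
    (η := 1 / (ν + 1)) (by positivity) (fun x hx => by simpa using hρ x hx)
    (by positivity) hV K le_rfl s hs
  have h2 : (K : ℝ) * (1 / (ν + 1)) ≤ 1 / (4 * P.invAcc) := by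
    rw [mul_one_div, div_le_div_iff₀ hν0 (by positivity)]
    have : (ν : ℝ) = 4 * K * P.invAcc := by
      rw [hν, planner]
      push_cast
      ring
    rw [this]
    linarith
  have h3 : (K : ℝ) * (F.targets.length * (1 / resolution I) * (K * R)) ≤
      1 / (4 * P.invAcc) := by
    have : (K : ℝ) * (F.targets.length * (1 / resolution I) * (K * R)) =
        (K ^ 2 * F.targets.length * R) / resolution I := by ring
    rw [this, div_le_div_iff₀ hΘ0 (by positivity)]
    have : (resolution I : ℝ) = 8 * K ^ 2 * P.b * F.targets.length * P.invAcc + 1 := by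
      rw [resolution, hI]
      push_cast
      ring
    rw [this, hRdef]
    linarith
  have hest : planner.estimate I D =
      (planZ F D (planner.samples I) K s : ℝ) / ((planner.samples I : ℝ) ^ K * ((ν + 1 : ℕ) : ℝ)) := by
    have h4 : 1 ≤ planner.samples I ^ K * (ν + 1) := Nat.succ_le_of_lt (by positivity)
    have h5 : planner.output I D = (planZ F D (planner.samples I) K s,
        planner.samples I ^ K * (ν + 1) - 1) := rfl
    rw [Learner.estimate, h5, Nat.cast_sub h4]
    push_cast
    rw [sub_add_cancel]
  rw [← hest] at hplan
  have h6 : 1 / (2 * (P.invAcc : ℝ)) + 1 / (4 * P.invAcc) + 1 / (4 * P.invAcc) =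
      1 / P.invAcc := by
    field_simp
    norm_num
  rw [mul_add] at hplan
  rw [abs_le] at *
  constructor <;> linarith [htrunc.1, htrunc.2, hplan.1, hplan.2]

theorem le_toOuterMeasure_isTypical_planner {s : State} {c₀ μ b α β : ℝ} (hβ : 0 < β)
    {P : Params} (hP : P.Bounds c₀ μ b α β) (ρ : Vertex → ℕ → ℤ) :
    ENNReal.ofReal (1 - β) ≤ (M.data ρ (planner.samples (P, F, s))).toOuterMeasure
      {D | M.IsTypical ρ (planner.samples (P, F, s)) (1 / resolution (P, F, s)) D} := by
  have hΘ0 : (0 : ℝ) < resolution (P, F, s) := Nat.cast_pos.2 (Nat.succ_pos _)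
  have hPβ := hP.2.2.2.2
  rw [div_le_iff₀ hβ] at hPβ
  refine M.le_toOuterMeasure_isTypical ρ (by positivity) (Nat.succ_pos _) ?_
  have h1 : (planner.samples (P, F, s) : ℝ) = F.queries.length * F.targets.length *
      resolution (P, F, s) ^ 2 * P.invConf + 1 := by
    simp [planner, sampleCount]
  rw [h1, div_pow, one_pow, one_div_mul_eq_div, mul_div_assoc', le_div_iff₀ (by positivity)]
  have h2 : (0 : ℝ) ≤ F.queries.length * F.targets.length * resolution (P, F, s) ^ 2 := by
    positivity
  nlinarith

end RMDP

end RecMDP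

end

theorem mainTheorem2 :
    ∃ L : RecMDP.Learner, L.IsComputable ∧
      ∀ (F : RecMDP.Frame), F.WF → ∀ (M : RecMDP.RMDP F) (ε c₀ μ b : ℝ),
        0 < ε → 1 ≤ c₀ → 0 < μ → μ ≤ 1 →
        M.EpsProper ε → M.FallingHeight ε c₀ μ → M.BoundedReward ε b →
        ∀ s : RecMDP.State, F.IsState s →
        ∀ α β : ℝ, 0 < α → 0 < β →
        ∀ P : RecMDP.Params, P.Bounds c₀ μ b α β →
        ∀ ρ : RecMDP.Vertex → ℕ → ℤ, M.IsReading (L.precision (P, F, s)) ρ →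
          ENNReal.ofReal (1 - β) ≤
            (M.data ρ (L.samples (P, F, s))).toOuterMeasure
              {D | |L.estimate (P, F, s) D - M.optReward s| ≤ α} := by
  refine ⟨RecMDP.planner, RecMDP.isComputable_planner, ?_⟩
  intro F hF M ε c₀ μ b hε _ hμ _ _ hM hb s hs α β hα hβ P hP ρ hρ
  refine (M.le_toOuterMeasure_isTypical_planner hβ hP ρ).trans (MeasureTheory.measure_mono ?_)
  intro D hD
  exact hD.abs_estimate_sub_optReward_le hF hε hμ hM hb hs hα hP hρ
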